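/- **Setting.** Fix integers $R,K,d$ and put $D=Rd$. Let $\vec\pi\in(0,1)^R$ with $\sum_i\pi(i)=1$; for each $i\in[R]$ let $\vec\pi_i$ be a vector of $K$ positive weights with $\sum_j\pi_i(j)=1$, and let $\xi_i(1),\dots,\xi_i(K)\in\mathbb R^{D}$. Let $$F=\sum_{i=1}^R\pi(i)\sum_{j=1}^{K}\pi_i(j)\,\delta_{\xi_i(j)},$$ where the support of $F$ has pairwise inner products in $[0,1]$, and assume that the second moment matrix $\Delta=\mathbb E_{X\sim F}[XX^\top]$ has rank $D$. For each $n$ let $(X,G)\sim\mathrm{RDPG}(F)$ on the vertex set $[n]$: $X_1,\dots,X_n$ are i.i.d. with law $F$ and, given $X$, the edges $\{u,v\}$, $u<v$, of the simple graph $G$ are independent, with probabilities $\langle X_u,X_v\rangle$ (a 2-level hierarchical stochastic blockmodel). Let $\tau:[n]\to[R]$ be the true assignment of vertices to subgraphs, that is, almost surely $X_v\in\{\xi_{\tau(v)}(1),\dots,\xi_{\tau(v)}(K)\}$ for all $v$. **Assumptions.** 1. (Affinity) $p<q$, where $p=\max_{i\ne j}\max_{\ell,h}\langle\xi_i(\ell),\xi_j(h)\rangle$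 and $q=\min_{i}\min_{\ell,h}\langle\xi_i(\ell),\xi_i(h)\rangle$. 2. (Subspace structure) The $RK\times Rd$ matrix $\xi$ whose rows are the $\xi_i(j)$, ordered by $i$, is $Z+\mathcal A$, where $Z$ is block diagonal with $R$ diagonal blocks of size $K\times d$, $Z\circ\mathcal A=0$ (Hadamard product), and the off block-diagonal entries of $\xi\xi^\top$ are at most $p$. **Embedding.** Let $A$ be the adjacency matrix of $G$ and $|A|=(A^\top A)^{1/2}$. An adjacency spectral embedding into $\mathbb R^D$ (for $n\ge D$) is $\widehat X=U_AS_A^{1/2}$, where $S_A$ is the diagonal matrix of the $D$ largest eigenvalues of $|A|$ in decreasing order, and the columns of $U_A$ are corresponding orthonormal eigenvectors. **Clustering (seeded nearest neighbor subspace clustering).** Start from a family $\mathcal S_0$ of $R$ rows of $\widehat X$. For $i=1,\dots,n$ let $\tilde y,\tilde z$ be two different members of the family $\mathcal S_{i-1}$ with maximal inner product. If $\max_{x\in\mathcal S_{i-1}}\langle\widehat X(i,:),x\rangle<\langle\tilde y,\tilde z\rangle$, obtain $\mathcal S_i$ from $\mathcal S_{i-1}$ by replacing $\tilde z$ by $\widehat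 X(i,:)$; if the maximum is larger than $\langle\tilde y,\tilde z\rangle$, let $\mathcal S_i=\mathcal S_{i-1}$; in case of equality either is allowed. With $\mathcal S_n=\{s_1,\dots,s_R\}$ (a family of $R$ members, counted with multiplicity) let $\hat\tau(v)\in\operatorname{argmax}_{j\in[R]}\langle\widehat X(v,:),s_j\rangle$ for each $v\in[n]$. **Claim.** Asymptotically almost surely, $$\min_{\sigma\in S_R}\sum_{v=1}^n\mathbf 1\{\hat\tau(v)\ne\sigma(\tau(v))\}=0$$ simultaneously for every adjacency spectral embedding $\widehat X$ of $A$, every initial family $\mathcal S_0$ (so in particular for a random sample of $R$ rows) and every way of breaking ties. Here events $E_n$ occur asymptotically almost surely if for every $c>0$ there is $n_0(c)$ such that $P(E_n)\ge1-\eta$ whenever $n>n_0(c)$ and $n^{-c}<\eta<1/2$. -/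

import Mathlib

open MeasureTheory ProbabilityTheory

noncomputable section

namespace HSBM

/-! ### Random dot product graphs -/

/-- The value at the graph `g` of the conditional law of a random dot product graph given the
latent positions `x`: the product over `u < v` of `⟨x u, x v⟩` when `u, v` are adjacent in `g` and
of `1 - ⟨x u, x v⟩` otherwise. -/
def edgeLikelihood {n D : ℕ} (x : Fin n → EuclideanSpace ℝ (Fin D))
    (g : SimpleGraph (Fin n)) : ℝ :=
  open Classical in
  ∏ u : Fin n, ∏ v ∈ Finset.Ioi u,
    if g.Adj u v then inner ℝ (x u) (x v) else 1 - inner ℝ (x u) (x v)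

/-- `(X, G) ∼ RDPG(F)` on `n` vertices. The distribution `F` lives on a set whose pairwise inner
products are in `[0, 1]`, the latent positions are i.i.d. with law `F`, and given them the graph
`G` has law `edgeLikelihood`. -/
structure IsRDPG {Ω : Type*} [MeasurableSpace Ω] (P : Measure Ω) {n D : ℕ}
    (F : Measure (EuclideanSpace ℝ (Fin D)))
    (X : Fin n → Ω → EuclideanSpace ℝ (Fin D)) (G : Ω → SimpleGraph (Fin n)) : Prop where
  inner_mem : ∃ 𝒳 : Set (EuclideanSpace ℝ (Fin D)), (∀ᵐ x ∂F, x ∈ 𝒳) ∧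
    ∀ x ∈ 𝒳, ∀ y ∈ 𝒳, inner ℝ x y ∈ Set.Icc (0 : ℝ) 1
  measurable_X : ∀ v, Measurable (X v)
  measurableSet_G : ∀ g, MeasurableSet {ω | G ω = g}
  indep : iIndepFun X P
  law : ∀ v, P.map (X v) = F
  cond_law : ∀ S : Set (Fin n → EuclideanSpace ℝ (Fin D)), MeasurableSet S →
    ∀ g : SimpleGraph (Fin n),
      P {ω | (fun v => X v ω) ∈ S ∧ G ω = g} =
        ∫⁻ ω in {ω | (fun v => X v ω) ∈ S}, ENNReal.ofReal (edgeLikelihood (fun v => X v ω) g) ∂P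

/-- The second moment matrix `Δ = 𝔼[X₁ X₁ᵀ]` of the distribution `F`. -/
def secondMoment {D : ℕ} (F : Measure (EuclideanSpace ℝ (Fin D))) : Matrix (Fin D) (Fin D) ℝ :=
  Matrix.of fun a b => ∫ x, x a * x b ∂F

/-! ### The two-level hierarchical stochastic blockmodel -/

/-- Parameters of a `D`-dimensional 2-level hierarchical stochastic blockmodel with `R` subgraphs,
the `i`-th of which has `K i` blocks. -/
structure Params (R : ℕ) (K : Fin R → ℕ) (D : ℕ) where
  /-- subgraph weights -/
  π : Fin R → ℝ
  /-- block weights inside each subgraph -/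
  πsub : ∀ i, Fin (K i) → ℝ
  /-- `ξ i j` is the latent position of block `j` of subgraph `i` -/
  ξ : ∀ i, Fin (K i) → EuclideanSpace ℝ (Fin D)
  π_mem : ∀ i, π i ∈ Set.Ioo (0 : ℝ) 1
  sum_π : ∑ i, π i = 1
  πsub_pos : ∀ i j, 0 < πsub i j
  sum_πsub : ∀ i, ∑ j, πsub i j = 1

namespace Params

variable {R : ℕ} {K : Fin R → ℕ} {D : ℕ}

/-- The mixture `F = ∑ᵢ π(i) ∑ⱼ πᵢ(j) δ_{ξᵢ(j)}`. -/
def dist (M : Params R K D) : Measure (EuclideanSpace ℝ (Fin D)) :=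
  ∑ i, ENNReal.ofReal (M.π i) • ∑ j, ENNReal.ofReal (M.πsub i j) • Measure.dirac (M.ξ i j)

/-- The minimal inner product of two latent positions of the same subgraph. -/
def q (M : Params R K D) : ℝ :=
  ⨅ x : Σ i, Fin (K i) × Fin (K i), inner ℝ (M.ξ x.1 x.2.1) (M.ξ x.1 x.2.2)

/-- The maximal inner product of two latent positions of different subgraphs. -/
def p (M : Params R K D) : ℝ :=
  ⨆ x : {x : (Σ i, Fin (K i)) × (Σ i, Fin (K i)) // x.1.1 ≠ x.2.1},
    inner ℝ (M.ξ x.1.1.1 x.1.1.2) (M.ξ x.1.2.1 x.1.2.2)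

/-- The affinity assumption. -/
def Affinity (M : Params R K D) : Prop := M.p < M.q

/-- The matrix whose rows are all the latent positions, subgraph by subgraph. -/
def latentMatrix (M : Params R K D) : Matrix (Σ i, Fin (K i)) (Fin D) ℝ :=
  Matrix.of fun r c => M.ξ r.1 r.2 c

end Params

/-- The block diagonal matrix with diagonal blocks `(ξ₀ i)ᵀ`, of size `K × d`, for `i < R`. -/
def blockDiag {R K d : ℕ} (ξ₀ : Fin R → Matrix (Fin d) (Fin K) ℝ) :
    Matrix (Σ _ : Fin R, Fin K) (Fin (R * d)) ℝ :=
  Matrix.of fun r c => if c.divNat = r.1 then ξ₀ r.1 c.modNat r.2 else 0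

/-- The subspace structure assumption: all subgraphs have `K` blocks, `D = R d`, and the matrix of
latent positions is `Z + 𝒜` with `Z` block diagonal, `Z ∘ 𝒜 = 0`, and the off block-diagonal
entries of `ξ ξᵀ` are at most `p`. -/
def SubspaceStructure {R K d : ℕ} (M : Params R (fun _ => K) (R * d)) : Prop :=
  ∃ (ξ₀ : Fin R → Matrix (Fin d) (Fin K) ℝ)
    (𝒜 : Matrix (Σ _ : Fin R, Fin K) (Fin (R * d)) ℝ),
    M.latentMatrix = blockDiag ξ₀ + 𝒜 ∧
    Matrix.hadamard (blockDiag ξ₀) 𝒜 = 0 ∧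
    ∀ r s : Σ _ : Fin R, Fin K, r.1 ≠ s.1 →
      (M.latentMatrix * M.latentMatrix.transpose) r s ≤ M.p

/-! ### Adjacency spectral embedding -/

/-- The rows `Xhat v` form an adjacency spectral embedding into `ℝ^D` of the matrix `A`:
`absA = (Aᵀ A)^{1/2}`, `absA = U diag(s) Uᵀ` is a spectral decomposition with ordered eigenvalues,
and `Xhat = U_A S_A^{1/2}` for the first `D` columns of `U` and the `D` largest eigenvalues. -/
def IsASE {n D : ℕ} (A : Matrix (Fin n) (Fin n) ℝ)
    (Xhat : Fin n → EuclideanSpace ℝ (Fin D)) : Prop :=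
  ∃ (hD : D ≤ n) (absA U : Matrix (Fin n) (Fin n) ℝ) (s : Fin n → ℝ),
    absA.PosSemidef ∧ absA * absA = A.transpose * A ∧
    U ∈ Matrix.orthogonalGroup (Fin n) ℝ ∧ Antitone s ∧
    absA = U * Matrix.diagonal s * U.transpose ∧
    ∀ v k, Xhat v k = U v (Fin.castLE hD k) * Real.sqrt (s (Fin.castLE hD k))

/-- The adjacency matrix of a graph. -/
def adjacency {n : ℕ} (g : SimpleGraph (Fin n)) : Matrix (Fin n) (Fin n) ℝ :=
  open Classical in g.adjMatrix ℝ

/-! ### Seeded nearest neighbor subspace clustering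

The seed set is a family of `R` vertices (standing for the corresponding rows of `Xhat`). -/

/-- One step of the seed selection, at vertex `v`. Here `y, z` are two different members of the
current seed family with maximal inner product; if every inner product of the row `v` with a seed
is smaller than that maximum, `z` is replaced by `v`; if one is larger, nothing changes; in case of
equality both are allowed. -/
def SeedStep {n D R : ℕ} (Xhat : Fin n → EuclideanSpace ℝ (Fin D)) (v : Fin n)
    (S S' : Fin R → Fin n) : Prop :=
  ∃ y z : Fin R, y ≠ z ∧
    (∀ y' z' : Fin R, y' ≠ z' →
      inner ℝ (Xhat (S y')) (Xhat (S z')) ≤ inner ℝ (Xhat (S y)) (Xhat (S z))) ∧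
    (((∀ k, inner ℝ (Xhat v) (Xhat (S k)) ≤ inner ℝ (Xhat (S y)) (Xhat (S z))) ∧
        S' = Function.update S z v) ∨
      ((∃ k, inner ℝ (Xhat (S y)) (Xhat (S z)) ≤ inner ℝ (Xhat v) (Xhat (S k))) ∧
        S' = S))

/-- `τhat` is a possible output of the clustering procedure on the rows of `Xhat`, for some initial
choice `S 0` of `R` rows and some way of breaking ties: the seeds are updated along the `n`
vertices, and each vertex then gets the label of a final seed with maximal inner product. -/
def IsClusteringOutput {n D R : ℕ} (Xhat : Fin n → EuclideanSpace ℝ (Fin D))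
    (τhat : Fin n → Fin R) : Prop :=
  ∃ S : Fin (n + 1) → Fin R → Fin n,
    (∀ v : Fin n, SeedStep Xhat v (S v.castSucc) (S v.succ)) ∧
    ∀ v j, inner ℝ (Xhat v) (Xhat (S (Fin.last n) j)) ≤
      inner ℝ (Xhat v) (Xhat (S (Fin.last n) (τhat v)))

/-- The number of misclustered vertices, up to a permutation of the labels:
`min_σ ∑ᵥ 1{τhat v ≠ σ (τ v)}`. -/
def clusteringError {n R : ℕ} (τhat τ : Fin n → Fin R) : ℕ :=
  ⨅ σ : Equiv.Perm (Fin R), ∑ v, if τhat v ≠ σ (τ v) then 1 else 0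

/-- The events `E n` occur asymptotically almost surely: for each `c > 0`, for `n` large and
`n ^ (-c) < η < 1/2`, the probability of `E n` is at least `1 - η`. -/
def AsymptoticallyAlmostSurely {Ω : ℕ → Type*} [∀ n, MeasurableSpace (Ω n)]
    (P : ∀ n, Measure (Ω n)) (E : ∀ n, Set (Ω n)) : Prop :=
  ∀ c : ℝ, 0 < c → ∃ n₀ : ℕ, ∀ n : ℕ, n₀ < n → ∀ η : ℝ, (n : ℝ) ^ (-c) < η → η < 1 / 2 →
    1 - η ≤ (P n).real (E n)

end HSBM

end

namespace HSBM

/-! ### Seeded nearest neighbor clustering with separated inner products -/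

section Clustering

variable {n D R : ℕ} {Xhat : Fin n → EuclideanSpace ℝ (Fin D)} {t : Fin n → Fin R} {m : ℝ}

/-- If inner products within the same label exceed `m` and inner products across labels are below
`m`, then a seed step keeps all labels covered so far and covers the label of the new vertex. -/
theorem SeedStep.range_subset
    (hsame : ∀ u v, t u = t v → m < inner ℝ (Xhat u) (Xhat v))
    (hdiff : ∀ u v, t u ≠ t v → inner ℝ (Xhat u) (Xhat v) < m)
    {v : Fin n} {S S' : Fin R → Fin n} (h : SeedStep Xhat v S S') :
    (∀ j, (∃ k, t (S k) = j) → ∃ k, t (S' k) = j) ∧ ∃ k, t (S' k) = t v := by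
  have hm : ∀ u v, m < inner ℝ (Xhat u) (Xhat v) → t u = t v := fun u v huv => by
    by_contra hne
    exact lt_asymm huv (hdiff u v hne)
  obtain ⟨y, z, hyz, hmax, ⟨hle, rfl⟩ | ⟨⟨k, hk⟩, hS⟩⟩ := h
  · refine ⟨?_, z, by simp⟩
    rintro j ⟨k, rfl⟩
    by_cases hkz : k = z
    · by_cases hgt : m < inner ℝ (Xhat (S y)) (Xhat (S z))
      · exact ⟨y, by rw [Function.update_of_ne hyz, hkz, hm _ _ hgt]⟩
      · have hinj : Function.Injective fun k => t (S k) := fun a b hab => by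
          by_contra hne
          exact hgt ((hsame _ _ hab).trans_le (hmax a b hne))
        obtain ⟨l, hl⟩ := (Finite.injective_iff_surjective.1 hinj) (t v)
        exact absurd ((hsame v (S l) hl.symm).trans_le (hle l)) hgt
    · exact ⟨k, by rw [Function.update_of_ne hkz]⟩
  · subst hS
    refine ⟨fun j hj => hj, ?_⟩
    by_contra hno
    have hnot : ¬ Function.Injective fun k => t (S' k) := fun hinj =>
      hno ((Finite.injective_iff_surjective.1 hinj) (t v))
    obtain ⟨a, b, hab, hne⟩ := Function.not_injective_iff.1 hnot
    exact hno ⟨k, (hm _ _ (((hsame _ _ hab).trans_le (hmax a b hne)).trans_le hk)).symm⟩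

/-- Clustering is exact when inner products within the same label exceed those across labels. -/
theorem IsClusteringOutput.clusteringError_eq_zero {τhat : Fin n → Fin R}
    (hsurj : Function.Surjective t)
    (hsame : ∀ u v, t u = t v → m < inner ℝ (Xhat u) (Xhat v))
    (hdiff : ∀ u v, t u ≠ t v → inner ℝ (Xhat u) (Xhat v) < m)
    (h : IsClusteringOutput Xhat τhat) : clusteringError τhat t = 0 := by
  obtain ⟨S, hstep, hout⟩ := h
  have key : ∀ i : Fin (n + 1), ∀ v : Fin n, v.val < i.val → ∃ k, t (S i k) = t v := by
    intro i
    induction i using Fin.induction with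
    | zero => intro v hv; simp at hv
    | succ i ih =>
      intro v hv
      obtain ⟨h1, h2⟩ := SeedStep.range_subset hsame hdiff (hstep i)
      rcases Nat.lt_succ_iff_lt_or_eq.1 (by simpa using hv : v.val < i.val + 1) with hlt | heq
      · exact h1 _ (ih v (by simpa using hlt))
      · rw [Fin.ext heq]; exact h2
  have hs : Function.Surjective fun k => t (S (Fin.last n) k) := fun j => by
    obtain ⟨v, rfl⟩ := hsurj j
    exact key _ v (by simp)
  let e := Equiv.ofBijective _ ⟨Finite.injective_iff_surjective.2 hs, hs⟩
  have hτ : ∀ v, τhat v = e.symm (t v) := fun v => by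
    rw [Equiv.eq_symm_apply]
    by_contra hne
    obtain ⟨k, hk⟩ := hs (t v)
    exact absurd ((hsame v _ hk.symm).trans_le (hout v k)) (hdiff v _ (Ne.symm hne)).le.not_gt
  have h0 := ciInf_le (OrderBot.bddBelow (Set.range fun σ : Equiv.Perm (Fin R) =>
    ∑ v, if τhat v ≠ σ (t v) then 1 else 0)) e.symm
  simp only [hτ, ne_eq, not_true_eq_false, if_false, Finset.sum_const_zero] at h0
  simpa [clusteringError, hτ] using h0

end Clustering

/-! ### Operator norms of real matrices -/

section OperatorNorm

open scoped Matrix.Norms.L2Operator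
open Matrix

variable {m n : Type*} [Fintype m] [Fintype n]

theorem l2_opNorm_transpose [DecidableEq m] [DecidableEq n] (M : Matrix m n ℝ) : ‖Mᵀ‖ = ‖M‖ := by
  rw [← l2_opNorm_conjTranspose M, conjTranspose_eq_transpose_of_trivial]

theorem l2_opNorm_transpose_mul_self [DecidableEq n] (M : Matrix m n ℝ) : ‖Mᵀ * M‖ = ‖M‖ * ‖M‖ := by
  rw [← l2_opNorm_conjTranspose_mul_self M, conjTranspose_eq_transpose_of_trivial]

theorem dotProduct_self_nonneg (x : n → ℝ) : 0 ≤ x ⬝ᵥ x :=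
  Finset.sum_nonneg fun i _ => mul_self_nonneg (x i)

theorem abs_dotProduct_le (x y : n → ℝ) : |x ⬝ᵥ y| ≤ √(x ⬝ᵥ x) * √(y ⬝ᵥ y) := by
  have h := abs_real_inner_le_norm (WithLp.toLp 2 x) (WithLp.toLp 2 y)
  simpa [EuclideanSpace.norm_eq, PiLp.inner_apply, dotProduct, mul_comm, ← pow_two] using h

theorem sqrt_dotProduct_mulVec_le [DecidableEq n] (M : Matrix m n ℝ) (x : n → ℝ) :
    √((M *ᵥ x) ⬝ᵥ (M *ᵥ x)) ≤ ‖M‖ * √(x ⬝ᵥ x) := by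
  have h := l2_opNorm_mulVec M (WithLp.toLp 2 x)
  simpa [EuclideanSpace.norm_eq, dotProduct, ← pow_two] using h

theorem abs_dotProduct_mulVec_le [DecidableEq n] (M : Matrix m n ℝ) (x : m → ℝ) (y : n → ℝ) :
    |x ⬝ᵥ M *ᵥ y| ≤ ‖M‖ * √(x ⬝ᵥ x) * √(y ⬝ᵥ y) :=
  calc _ ≤ √(x ⬝ᵥ x) * √((M *ᵥ y) ⬝ᵥ (M *ᵥ y)) := abs_dotProduct_le _ _
    _ ≤ √(x ⬝ᵥ x) * (‖M‖ * √(y ⬝ᵥ y)) := by gcongr; exact sqrt_dotProduct_mulVec_le M y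
    _ = _ := by ring

theorem abs_dotProduct_mulVec_self_le [DecidableEq n] (M : Matrix n n ℝ) (x : n → ℝ) :
    |x ⬝ᵥ M *ᵥ x| ≤ ‖M‖ * (x ⬝ᵥ x) := by
  have h := abs_dotProduct_mulVec_le M x x
  rwa [mul_assoc, Real.mul_self_sqrt (dotProduct_self_nonneg x)] at h

theorem abs_entry_le_l2_opNorm [DecidableEq m] [DecidableEq n] (M : Matrix m n ℝ) (i : m) (j : n) : |M i j| ≤ ‖M‖ := by
  simpa using abs_dotProduct_mulVec_le M (Pi.single i 1) (Pi.single j 1)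

/-- The operator norm is at most the Frobenius norm. -/
theorem l2_opNorm_le_sqrt_sum [DecidableEq n] (M : Matrix m n ℝ) : ‖M‖ ≤ √(∑ i, ∑ j, M i j ^ 2) := by
  rw [l2_opNorm_def]
  refine ContinuousLinearMap.opNorm_le_bound _ (Real.sqrt_nonneg _) fun x => ?_
  rw [EuclideanSpace.norm_eq, EuclideanSpace.norm_eq, ← Real.sqrt_mul (by positivity)]
  refine Real.sqrt_le_sqrt ?_
  rw [Finset.sum_mul]
  refine Finset.sum_le_sum fun i _ => ?_
  simp only [Real.norm_eq_abs, sq_abs]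
  exact Finset.sum_mul_sq_le_sq_mul_sq Finset.univ (M i) x.ofLp

theorem l2_opNorm_le_of_sum_sq_le [DecidableEq n] {M : Matrix m n ℝ} {c : ℝ} (hc : 0 ≤ c)
    (h : ∑ i, ∑ j, M i j ^ 2 ≤ c ^ 2) : ‖M‖ ≤ c :=
  (l2_opNorm_le_sqrt_sum M).trans (Real.sqrt_le_iff.2 ⟨hc, h⟩)

theorem l2_opNorm_le_of_mem_orthogonalGroup [DecidableEq n] {U : Matrix n n ℝ} (hU : U ∈ orthogonalGroup n ℝ) :
    ‖U‖ ≤ 1 := by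
  have h1 : Uᵀ * U = 1 := (mem_orthogonalGroup_iff' n ℝ).1 hU
  have h2 : ‖(1 : Matrix n n ℝ)‖ ≤ 1 := by
    rw [← diagonal_one, l2_opNorm_diagonal]
    exact (pi_norm_le_iff_of_nonneg zero_le_one).2 (by simp)
  have h3 := l2_opNorm_transpose_mul_self U
  rw [h1] at h3
  nlinarith [norm_nonneg U]

/-- The square root is `1/2`-Hölder on positive semidefinite matrices. -/
theorem sq_l2_opNorm_sub_le [DecidableEq n] {a b : Matrix n n ℝ} (ha : a.PosSemidef) (hb : b.PosSemidef) :
    ‖a - b‖ ^ 2 ≤ ‖a * a - b * b‖ := by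
  have hH : (a - b).IsHermitian := ha.isHermitian.sub hb.isHermitian
  have hat : aᵀ = a := by simpa using ha.isHermitian.eq
  have hbt : bᵀ = b := by simpa using hb.isHermitian.eq
  suffices h : ‖a - b‖ ≤ √‖a * a - b * b‖ by
    calc _ ≤ √‖a * a - b * b‖ ^ 2 := by gcongr
      _ = _ := Real.sq_sqrt (norm_nonneg _)
  have hle : ‖a - b‖ ≤ ‖(diagonal hH.eigenvalues : Matrix n n ℝ)‖ := by
    set V : Matrix n n ℝ := hH.eigenvectorUnitary.1
    have hV : V ∈ orthogonalGroup n ℝ := hH.eigenvectorUnitary.2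
    have hV' : ‖star V‖ ≤ 1 := l2_opNorm_le_of_mem_orthogonalGroup (Unitary.star_mem hV)
    have hs : a - b = V * diagonal hH.eigenvalues * star V := by
      have := hH.spectral_theorem
      rwa [Unitary.conjStarAlgAut_apply] at this
    calc ‖a - b‖ = ‖V * diagonal hH.eigenvalues * star V‖ := by rw [← hs]
      _ ≤ ‖V‖ * ‖diagonal hH.eigenvalues‖ * ‖star V‖ :=
        (norm_mul_le _ _).trans (by gcongr; exact norm_mul_le _ _)
      _ ≤ 1 * ‖diagonal hH.eigenvalues‖ * 1 := by
        gcongr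
        exact l2_opNorm_le_of_mem_orthogonalGroup hV
      _ = _ := by ring
  refine hle.trans ?_
  rw [l2_opNorm_diagonal]
  refine (pi_norm_le_iff_of_nonneg (Real.sqrt_nonneg _)).2 fun i => ?_
  refine Real.le_sqrt_of_sq_le ?_
  set v : n → ℝ := (hH.eigenvectorBasis i).ofLp
  set μ := hH.eigenvalues i
  have hv : (a - b) *ᵥ v = μ • v := hH.mulVec_eigenvectorBasis i
  have hvv : v ⬝ᵥ v = 1 := by
    have := EuclideanSpace.real_norm_sq_eq (hH.eigenvectorBasis i)
    rw [hH.eigenvectorBasis.norm_eq_one] at this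
    simpa [dotProduct, ← pow_two, v] using this.symm
  have hsymm : ∀ {c : Matrix n n ℝ}, cᵀ = c → ∀ x y : n → ℝ, x ⬝ᵥ c *ᵥ y = (c *ᵥ x) ⬝ᵥ y := by
    intro c hc x y
    rw [dotProduct_mulVec, ← mulVec_transpose, hc]
  have h1 : v ⬝ᵥ (a * a - b * b) *ᵥ v = μ * (v ⬝ᵥ a *ᵥ v + v ⬝ᵥ b *ᵥ v) := by
    have e1 : a *ᵥ v = b *ᵥ v + μ • v := by rw [← hv, sub_mulVec]; abel
    rw [sub_mulVec, ← mulVec_mulVec, ← mulVec_mulVec, dotProduct_sub, hsymm hat, hsymm hbt]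
    have e2 : v ⬝ᵥ a *ᵥ v = v ⬝ᵥ b *ᵥ v + μ * (v ⬝ᵥ v) := by
      rw [e1, dotProduct_add, dotProduct_smul, smul_eq_mul]
    rw [e2, e1]
    simp only [add_dotProduct, dotProduct_add, smul_dotProduct, dotProduct_smul, smul_eq_mul, hvv,
      dotProduct_comm (b *ᵥ v) v]
    ring
  have h2 : v ⬝ᵥ a *ᵥ v - v ⬝ᵥ b *ᵥ v = μ := by
    rw [← dotProduct_sub, ← sub_mulVec, hv, dotProduct_smul, hvv, smul_eq_mul, mul_one]
  have ha' : 0 ≤ v ⬝ᵥ a *ᵥ v := by simpa using ha.dotProduct_mulVec_nonneg v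
  have hb' : 0 ≤ v ⬝ᵥ b *ᵥ v := by simpa using hb.dotProduct_mulVec_nonneg v
  have h3 := abs_dotProduct_mulVec_self_le (a * a - b * b) v
  rw [h1, hvv, mul_one, abs_mul] at h3
  refine le_trans ?_ h3
  rw [Real.norm_eq_abs, pow_two]
  refine mul_le_mul_of_nonneg_left ?_ (abs_nonneg μ)
  rw [abs_of_nonneg (add_nonneg ha' hb'), ← h2]
  exact abs_sub_le_iff.2 ⟨by linarith, by linarith⟩

end OperatorNorm

/-! ### Perturbation of a spectral truncation -/

section Perturbation

open scoped Matrix.Norms.L2Operator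
open Matrix

variable {n D : ℕ}

theorem dotProduct_spectral (U : Matrix (Fin n) (Fin n) ℝ) (s x : Fin n → ℝ) :
    x ⬝ᵥ (U * diagonal s * Uᵀ) *ᵥ x = ∑ i, s i * (Uᵀ *ᵥ x) i ^ 2 := by
  rw [← mulVec_mulVec, ← mulVec_mulVec, dotProduct_mulVec, ← mulVec_transpose]
  simp only [dotProduct, mulVec_diagonal]
  exact Finset.sum_congr rfl fun i _ => by ring

theorem sum_sq_orthogonal {U : Matrix (Fin n) (Fin n) ℝ} (hU : U ∈ orthogonalGroup (Fin n) ℝ)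
    (x : Fin n → ℝ) : ∑ i, (Uᵀ *ᵥ x) i ^ 2 = x ⬝ᵥ x := by
  have h := dotProduct_spectral U (fun _ => 1) x
  simp only [one_mul] at h
  rw [← h, show diagonal (fun _ : Fin n => (1 : ℝ)) = 1 from diagonal_one, mul_one,
    (mem_orthogonalGroup_iff (Fin n) ℝ).1 hU, one_mulVec]

/-- The eigenvalues beyond the rank of `Y Yᵀ` of a matrix close to `Y Yᵀ` are small. -/
theorem eigenvalue_le_of_rank_le {U a : Matrix (Fin n) (Fin n) ℝ} {s : Fin n → ℝ}
    (hU : U ∈ orthogonalGroup (Fin n) ℝ) (hs : Antitone s) (ha : a = U * diagonal s * Uᵀ)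
    (Y : Matrix (Fin n) (Fin D) ℝ) {k : Fin n} (hk : D ≤ k.val) : s k ≤ ‖a - Y * Yᵀ‖ := by
  let f : (Fin n → ℝ) →ₗ[ℝ] (Fin D → ℝ) × ({i : Fin n // k < i} → ℝ) :=
    LinearMap.prod (Matrix.mulVecLin (Yᵀ * U)) (LinearMap.funLeft ℝ ℝ Subtype.val)
  have hf : LinearMap.ker f ≠ ⊥ := by
    refine LinearMap.ker_ne_bot_of_finrank_lt ?_
    have hc : Fintype.card {i : Fin n // k < i} = n - 1 - k.val := by
      rw [Fintype.card_subtype, Finset.filter_lt_eq_Ioi, Fin.card_Ioi]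
    rw [Module.finrank_prod, Module.finrank_pi, Module.finrank_pi, Module.finrank_pi, hc,
      Fintype.card_fin, Fintype.card_fin]
    have := k.2
    omega
  obtain ⟨c, hc, hc0⟩ := (Submodule.ne_bot_iff _).1 hf
  have hc1 : (Yᵀ * U) *ᵥ c = 0 := congrArg Prod.fst (LinearMap.mem_ker.1 hc)
  have hc2 : ∀ i, k < i → c i = 0 := fun i hi =>
    congrFun (congrArg Prod.snd (LinearMap.mem_ker.1 hc)) ⟨i, hi⟩
  have hUU : Uᵀ * U = 1 := (mem_orthogonalGroup_iff' (Fin n) ℝ).1 hU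
  set x := U *ᵥ c
  have hxc : Uᵀ *ᵥ x = c := by rw [mulVec_mulVec, hUU, one_mulVec]
  have hYx : Yᵀ *ᵥ x = 0 := by rw [mulVec_mulVec, hc1]
  have hxx : ∑ i, c i ^ 2 = x ⬝ᵥ x := by rw [← sum_sq_orthogonal hU x, hxc]
  have hpos : 0 < x ⬝ᵥ x := by
    rw [← hxx]
    obtain ⟨i, hi⟩ := Function.ne_iff.1 hc0
    exact Finset.sum_pos' (fun i _ => sq_nonneg _) ⟨i, Finset.mem_univ i, by
      have : c i ≠ 0 := hi
      positivity⟩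
  have h1 : s k * (x ⬝ᵥ x) ≤ x ⬝ᵥ a *ᵥ x := by
    rw [ha, dotProduct_spectral, hxc, ← hxx, Finset.mul_sum]
    refine Finset.sum_le_sum fun i _ => ?_
    rcases lt_or_ge k i with hi | hi
    · simp [hc2 i hi]
    · exact mul_le_mul_of_nonneg_right (hs hi) (sq_nonneg _)
  have h2 := (le_abs_self _).trans (abs_dotProduct_mulVec_self_le (a - Y * Yᵀ) x)
  rw [sub_mulVec, dotProduct_sub, ← mulVec_mulVec, hYx, mulVec_zero, dotProduct_zero, sub_zero]
    at h2
  exact le_of_mul_le_mul_right (h1.trans h2) hpos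

/-- The first `D` eigenvalues of a matrix close to `Y Yᵀ` are bounded below in terms of the
inverse of `Yᵀ Y`. -/
theorem le_eigenvalue_of_gram_inverse {U a : Matrix (Fin n) (Fin n) ℝ} {s : Fin n → ℝ}
    (hU : U ∈ orthogonalGroup (Fin n) ℝ) (hs : Antitone s) (ha : a = U * diagonal s * Uᵀ)
    (Y : Matrix (Fin n) (Fin D) ℝ) {C' : Matrix (Fin D) (Fin D) ℝ} (hC : C' * (Yᵀ * Y) = 1)
    {k : Fin n} (hk : k.val < D) (hsk : 0 ≤ s k) : 1 ≤ (s k + ‖a - Y * Yᵀ‖) * ‖C'‖ := by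
  let f : (Fin D → ℝ) →ₗ[ℝ] (Fin k.val → ℝ) :=
    (LinearMap.funLeft ℝ ℝ (Fin.castLE k.2.le)).comp (Matrix.mulVecLin (Uᵀ * Y))
  have hf : LinearMap.ker f ≠ ⊥ := LinearMap.ker_ne_bot_of_finrank_lt (by simpa using hk)
  obtain ⟨y, hy, hy0⟩ := (Submodule.ne_bot_iff _).1 hf
  set x := Y *ᵥ y
  set z := Yᵀ *ᵥ x
  have hzy : C' *ᵥ z = y := by
    rw [mulVec_mulVec, mulVec_mulVec, Matrix.mul_assoc, hC, one_mulVec]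
  have hx0 : ∀ i, i < k → (Uᵀ *ᵥ x) i = 0 := fun i hi => by
    have := congrFun (LinearMap.mem_ker.1 hy) ⟨i.val, hi⟩
    rw [mulVec_mulVec]
    exact this
  have hz0 : z ≠ 0 := fun h => hy0 (by rw [← hzy, h, mulVec_zero])
  have hpos : 0 < z ⬝ᵥ z := by
    obtain ⟨i, hi⟩ := Function.ne_iff.1 hz0
    exact Finset.sum_pos' (fun i _ => mul_self_nonneg _) ⟨i, Finset.mem_univ i, by
      have : z i ≠ 0 := hi
      exact mul_self_pos.2 this⟩
  have hxx : x ⬝ᵥ x ≤ ‖C'‖ * (z ⬝ᵥ z) := by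
    have : x ⬝ᵥ x = z ⬝ᵥ C' *ᵥ z := by
      rw [hzy]
      change x ⬝ᵥ Y *ᵥ y = (Yᵀ *ᵥ x) ⬝ᵥ y
      rw [dotProduct_mulVec, ← mulVec_transpose]
    rw [this]
    exact (le_abs_self _).trans (abs_dotProduct_mulVec_self_le C' z)
  have h1 : x ⬝ᵥ a *ᵥ x ≤ s k * (x ⬝ᵥ x) := by
    rw [ha, dotProduct_spectral, ← sum_sq_orthogonal hU x, Finset.mul_sum]
    refine Finset.sum_le_sum fun i _ => ?_
    rcases lt_or_ge i k with hi | hi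
    · simp [hx0 i hi]
    · exact mul_le_mul_of_nonneg_right (hs hi) (sq_nonneg _)
  have h2 := (neg_le_abs _).trans (abs_dotProduct_mulVec_self_le (a - Y * Yᵀ) x)
  have h3 : x ⬝ᵥ (Y * Yᵀ) *ᵥ x = z ⬝ᵥ z := by
    rw [← mulVec_mulVec, dotProduct_mulVec, ← mulVec_transpose]
  rw [sub_mulVec, dotProduct_sub, h3] at h2
  have h4 : z ⬝ᵥ z ≤ (s k + ‖a - Y * Yᵀ‖) * (‖C'‖ * (z ⬝ᵥ z)) := by
    refine le_trans ?_ (mul_le_mul_of_nonneg_left hxx (by positivity))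
    linarith
  exact le_of_mul_le_mul_right (by linarith) hpos

/-- `U diag(d) Uᵀ`. -/
def conjDiag (U : Matrix (Fin n) (Fin n) ℝ) (d : Fin n → ℝ) : Matrix (Fin n) (Fin n) ℝ :=
  U * diagonal d * Uᵀ

theorem conjDiag_transpose (U : Matrix (Fin n) (Fin n) ℝ) (d : Fin n → ℝ) :
    (conjDiag U d)ᵀ = conjDiag U d := by
  simp [conjDiag, Matrix.mul_assoc]

theorem conjDiag_mul {U : Matrix (Fin n) (Fin n) ℝ} (hU : U ∈ orthogonalGroup (Fin n) ℝ)
    (d d' : Fin n → ℝ) : conjDiag U d * conjDiag U d' = conjDiag U fun i => d i * d' i := by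
  have hUU : Uᵀ * U = 1 := (mem_orthogonalGroup_iff' (Fin n) ℝ).1 hU
  calc _ = U * diagonal d * (Uᵀ * U) * diagonal d' * Uᵀ := by
        simp only [conjDiag, Matrix.mul_assoc]
    _ = _ := by rw [hUU, Matrix.mul_one, Matrix.mul_assoc U, diagonal_mul_diagonal, conjDiag]

theorem conjDiag_sub (U : Matrix (Fin n) (Fin n) ℝ) (d d' : Fin n → ℝ) :
    conjDiag U d - conjDiag U d' = conjDiag U fun i => d i - d' i := by
  rw [conjDiag, conjDiag, conjDiag, ← sub_mul, ← mul_sub, diagonal_sub]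

theorem conjDiag_one {U : Matrix (Fin n) (Fin n) ℝ} (hU : U ∈ orthogonalGroup (Fin n) ℝ) :
    conjDiag U (fun _ => 1) = 1 := by
  rw [conjDiag, show diagonal (fun _ : Fin n => (1 : ℝ)) = 1 from diagonal_one, mul_one,
    (mem_orthogonalGroup_iff (Fin n) ℝ).1 hU]

theorem norm_conjDiag_le {U : Matrix (Fin n) (Fin n) ℝ} (hU : U ∈ orthogonalGroup (Fin n) ℝ)
    {d : Fin n → ℝ} {c : ℝ} (hc : 0 ≤ c) (hd : ∀ i, |d i| ≤ c) : ‖conjDiag U d‖ ≤ c := by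
  have h1 := l2_opNorm_le_of_mem_orthogonalGroup hU
  have h2 : ‖(diagonal d : Matrix (Fin n) (Fin n) ℝ)‖ ≤ c := by
    rw [l2_opNorm_diagonal]
    exact (pi_norm_le_iff_of_nonneg hc).2 hd
  calc _ ≤ ‖U‖ * ‖(diagonal d : Matrix (Fin n) (Fin n) ℝ)‖ * ‖Uᵀ‖ :=
        (norm_mul_le _ _).trans (by gcongr; exact norm_mul_le _ _)
    _ ≤ 1 * c * 1 := by
        rw [l2_opNorm_transpose]
        gcongr
    _ = c := by ring

theorem norm_bilin_sub_le {l : ℕ} (Q : Matrix (Fin n) (Fin n) ℝ)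
    (u u' w w' : Matrix (Fin n) (Fin l) ℝ) :
    ‖uᵀ * Q * w - u'ᵀ * Q * w'‖ ≤ ‖u - u'‖ * ‖Q‖ * ‖w‖ + ‖u'‖ * ‖Q‖ * ‖w - w'‖ := by
  have h : uᵀ * Q * w - u'ᵀ * Q * w' = (u - u')ᵀ * Q * w + u'ᵀ * Q * (w - w') := by
    rw [transpose_sub, Matrix.sub_mul, Matrix.sub_mul, Matrix.mul_sub]
    abel
  have h3 : ∀ (u w : Matrix (Fin n) (Fin l) ℝ), ‖uᵀ * Q * w‖ ≤ ‖u‖ * ‖Q‖ * ‖w‖ := fun u w => by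
    rw [← l2_opNorm_transpose u]
    exact (l2_opNorm_mul _ _).trans (by gcongr; exact l2_opNorm_mul _ _)
  rw [h]
  exact (norm_add_le _ _).trans (add_le_add (h3 _ _) (h3 _ _))

/-- Truncation of `s` to the first `D` coordinates. -/
def trunc (D : ℕ) (s : Fin n → ℝ) (i : Fin n) : ℝ := if i.val < D then s i else 0

set_option maxHeartbeats 1000000 in
/-- Let `α` be close to `Y Yᵀ`, and let `a = |α| = U diag(s) Uᵀ`. The truncation of `a` to its `D`
largest eigenvalues is close to `Y Yᵀ` as a bilinear form on vectors `f, g` that are delocalized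
with respect to `α` and `Y`. -/
theorem norm_trunc_sub_le {α a U : Matrix (Fin n) (Fin n) ℝ} {s : Fin n → ℝ}
    {Y : Matrix (Fin n) (Fin D) ℝ} {C' : Matrix (Fin D) (Fin D) ℝ} {B ε ε₁ : ℝ}
    (ha : a.PosSemidef) (haα : a * a = α * α)
    (hU : U ∈ orthogonalGroup (Fin n) ℝ) (hs : Antitone s) (haU : a = conjDiag U s)
    (hs0 : ∀ i, 0 ≤ s i)
    (hα1 : ‖α‖ ≤ 1) (hY : ‖Y‖ ≤ 1) (hC : C' * (Yᵀ * Y) = 1) (hC' : (Yᵀ * Y) * C' = 1)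
    (hB : 1 ≤ B) (hCB : ‖C'‖ ≤ B) (hε : ‖α - Y * Yᵀ‖ ≤ ε)
    (hε₁ : 0 ≤ ε₁) (hεε₁ : ε ≤ ε₁) (h2ε : 2 * ε ≤ ε₁ ^ 2) (hεB : 2 * B * ε₁ ≤ 1)
    {l : ℕ} {f g : Matrix (Fin n) (Fin l) ℝ} (hf : ‖α * f‖ ≤ 1) (hf' : ‖Y * Yᵀ * f‖ ≤ 1)
    (hfε : ‖Yᵀ * ((α - Y * Yᵀ) * f)‖ ≤ ε) (hg : ‖α * g‖ ≤ 1)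
    (hgε : ‖Yᵀ * ((α - Y * Yᵀ) * g)‖ ≤ ε) :
    ‖fᵀ * conjDiag U (trunc D s) * g - fᵀ * (Y * Yᵀ) * g‖ ≤ 168 * B ^ 8 * ε₁ := by
  set p := Y * Yᵀ with hp
  set H := conjDiag U (trunc D s) with hH
  set Pr := conjDiag U (trunc D fun _ => 1) with hPr
  set J := conjDiag U (trunc D fun i => (s i ^ 2)⁻¹) with hJ
  set Q := Y * (C' * C' * C' * C') * Yᵀ with hQ
  have hB0 : 0 < B := by linarith
  have hpnorm : ‖p‖ ≤ 1 := by
    calc _ ≤ ‖Y‖ * ‖Yᵀ‖ := l2_opNorm_mul _ _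
      _ ≤ 1 * 1 := by rw [l2_opNorm_transpose]; gcongr
      _ = 1 := one_mul 1
  have hpsd : p.PosSemidef := by
    simpa [conjTranspose_eq_transpose_of_trivial] using posSemidef_self_mul_conjTranspose Y
  have hap : ‖a - p‖ ≤ ε₁ := by
    have h1 := sq_l2_opNorm_sub_le ha hpsd
    have h2 : ‖a * a - p * p‖ ≤ 2 * ε := by
      rw [haα, show α * α - p * p = α * (α - p) + (α - p) * p by noncomm_ring]
      calc _ ≤ ‖α‖ * ‖α - p‖ + ‖α - p‖ * ‖p‖ :=
            (norm_add_le _ _).trans (add_le_add (norm_mul_le _ _) (norm_mul_le _ _))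
        _ ≤ 1 * ε + ε * 1 := by
            have : 0 ≤ ε := (norm_nonneg _).trans hε
            gcongr
        _ = _ := by ring
    exact abs_le_of_sq_le_sq' ((h1.trans h2).trans h2ε) hε₁ |>.2
  have hsmall : ∀ k : Fin n, D ≤ k.val → s k ≤ ε₁ := fun k hk =>
    (eigenvalue_le_of_rank_le hU hs haU Y hk).trans hap
  have hlarge : ∀ k : Fin n, k.val < D → 1 / (2 * B) ≤ s k := fun k hk => by
    have h1 := le_eigenvalue_of_gram_inverse hU hs haU Y hC hk (hs0 k)
    have h2 : 1 ≤ (s k + ε₁) * B := h1.trans (by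
      have := hs0 k
      gcongr)
    rw [div_le_iff₀ (by positivity)]
    linarith
  have hspos : ∀ k : Fin n, k.val < D → s k ≠ 0 := fun k hk =>
    (lt_of_lt_of_le (by positivity) (hlarge k hk)).ne'
  have hPr1 : ‖Pr‖ ≤ 1 := norm_conjDiag_le hU zero_le_one fun i => by
    unfold trunc; split_ifs <;> simp
  have hPr1' : ‖1 - Pr‖ ≤ 1 := by
    rw [← conjDiag_one hU, conjDiag_sub]
    exact norm_conjDiag_le hU zero_le_one fun i => by unfold trunc; split_ifs <;> simp
  have hJB : ‖J‖ ≤ 4 * B ^ 2 := norm_conjDiag_le hU (by positivity) fun i => by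
    unfold trunc
    split_ifs with hi
    · have h1 := hlarge i hi
      rw [abs_of_nonneg (by positivity), inv_le_comm₀ (by have := hspos i hi; positivity)
        (by positivity)]
      calc (4 * B ^ 2)⁻¹ = (1 / (2 * B)) ^ 2 := by field_simp; norm_num
        _ ≤ _ := by gcongr
    · simp; positivity
  have ha1 : ‖a‖ ≤ 1 := by
    have h1 := l2_opNorm_transpose_mul_self a
    rw [haU, conjDiag_transpose, ← haU, haα] at h1
    have h2 : ‖α * α‖ ≤ 1 * 1 := (norm_mul_le _ _).trans (by gcongr)
    nlinarith [norm_nonneg a]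
  have hHa : H = Pr * a := by
    rw [haU, hPr, conjDiag_mul hU, hH]
    congr 1; ext i; unfold trunc; split_ifs <;> simp
  have hH1 : ‖H‖ ≤ 1 := by
    rw [hHa]
    calc _ ≤ ‖Pr‖ * ‖a‖ := norm_mul_le _ _
      _ ≤ 1 * 1 := by gcongr
      _ = 1 := one_mul 1
  have haH : ‖a - H‖ ≤ ε₁ := by
    rw [haU, conjDiag_sub]
    refine norm_conjDiag_le hU hε₁ fun i => ?_
    unfold trunc
    split_ifs with hi
    · simpa using hε₁
    · rw [sub_zero, abs_of_nonneg (hs0 i)]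
      exact hsmall i (not_lt.1 hi)
  have hHp : ‖H - p‖ ≤ 2 * ε₁ := by
    calc ‖H - p‖ = ‖(a - p) - (a - H)‖ := by congr 1; abel
      _ ≤ ‖a - p‖ + ‖a - H‖ := norm_sub_le _ _
      _ ≤ 2 * ε₁ := by linarith
  have hPrH : Pr * H = H := by
    rw [hPr, hH, conjDiag_mul hU]
    congr 1; ext i; unfold trunc; split_ifs <;> simp
  have hHH : H * H = Pr * (α * α) := by
    rw [← haα, haU, hPr, hH, conjDiag_mul hU, conjDiag_mul hU, conjDiag_mul hU]
    congr 1; ext i; unfold trunc; split_ifs <;> simp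
  have hHHJ : H * H * J = Pr := by
    rw [hPr, hH, hJ, conjDiag_mul hU, conjDiag_mul hU]
    congr 1; ext i; unfold trunc
    split_ifs with hi
    · have := hspos i hi
      field_simp
    · simp
  have hJHH : J * (H * H) = Pr := by
    rw [hPr, hH, hJ, conjDiag_mul hU, conjDiag_mul hU]
    congr 1; ext i; unfold trunc
    split_ifs with hi
    · have := hspos i hi
      field_simp
    · simp
  have hHPr : H * Pr = H := by
    rw [hPr, hH, conjDiag_mul hU]
    congr 1; ext i; unfold trunc; split_ifs <;> simp
  have hHt : Hᵀ = H := conjDiag_transpose _ _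
  have hpt : pᵀ = p := by simp [hp]
  have hQ1 : ‖Q‖ ≤ B ^ 4 := by
    calc _ ≤ ‖Y‖ * (‖C'‖ * ‖C'‖ * ‖C'‖ * ‖C'‖) * ‖Yᵀ‖ := by
          refine (l2_opNorm_mul _ _).trans ?_
          gcongr
          refine (l2_opNorm_mul _ _).trans ?_
          gcongr
          refine (l2_opNorm_mul _ _).trans ?_
          gcongr
          refine (l2_opNorm_mul _ _).trans ?_
          gcongr
          exact l2_opNorm_mul _ _
      _ ≤ 1 * (B * B * B * B) * 1 := by
          rw [l2_opNorm_transpose]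
          gcongr
      _ = B ^ 4 := by ring
  have hpQp : p * p * Q * (p * p) = p := by
    set C := Yᵀ * Y with hCdef
    have h1 : p * p = Y * C * Yᵀ := by simp only [hp, hCdef, Matrix.mul_assoc]
    have h2 : C * C * (C' * C' * C' * C') * (C * C) = 1 := by
      calc _ = C * (C * C') * C' * C' * (C' * C) * C := by noncomm_ring
        _ = (C * C') * (C' * C) := by simp only [hC, hC', mul_one, one_mul]
        _ = 1 := by rw [hC, hC', one_mul]
    calc p * p * Q * (p * p) = Y * (C * C * (C' * C' * C' * C') * (C * C)) * Yᵀ := by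
          rw [h1, hQ]
          simp only [hCdef, Matrix.mul_assoc]
      _ = p := by rw [h2, Matrix.mul_one]
  have hPrαp : ‖Pr * α - p‖ ≤ 3 * ε₁ := by
    have h1 : Pr * α - p = Pr * (α - p) - (1 - Pr) * (p - H) := by
      rw [sub_mul 1 Pr, mul_sub Pr, mul_sub Pr, hPrH, one_mul]; abel
    rw [h1]
    calc _ ≤ ‖Pr‖ * ‖α - p‖ + ‖1 - Pr‖ * ‖p - H‖ :=
          (norm_sub_le _ _).trans (add_le_add (norm_mul_le _ _) (norm_mul_le _ _))
      _ ≤ 1 * ε₁ + 1 * (2 * ε₁) := by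
          rw [norm_sub_rev p H]
          gcongr
          exact hε.trans hεε₁
      _ = _ := by ring
  have hHHp : ∀ {f : Matrix (Fin n) (Fin l) ℝ}, ‖α * f‖ ≤ 1 → ‖Yᵀ * ((α - p) * f)‖ ≤ ε →
      ‖H * H * f - p * p * f‖ ≤ 4 * ε₁ := by
    intro f hf hfε
    have h1 : H * H * f - p * p * f = (Pr * α - p) * (α * f) + Y * (Yᵀ * ((α - p) * f)) := by
      rw [hHH, ← Matrix.mul_assoc Y, ← hp]
      simp only [Matrix.sub_mul, Matrix.mul_sub, Matrix.mul_assoc]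
      abel
    rw [h1]
    calc _ ≤ ‖Pr * α - p‖ * ‖α * f‖ + ‖Y‖ * ‖Yᵀ * ((α - p) * f)‖ :=
          (norm_add_le _ _).trans (add_le_add (l2_opNorm_mul _ _) (l2_opNorm_mul _ _))
      _ ≤ 3 * ε₁ * 1 + 1 * ε₁ := by
          gcongr
          exact hfε.trans hεε₁
      _ = _ := by ring
  have hHH1 : ∀ {f : Matrix (Fin n) (Fin l) ℝ}, ‖α * f‖ ≤ 1 → ‖H * H * f‖ ≤ 1 := by
    intro f hf
    calc ‖H * H * f‖ = ‖Pr * (α * (α * f))‖ := by rw [hHH]; simp only [Matrix.mul_assoc]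
      _ ≤ ‖Pr‖ * (‖α‖ * ‖α * f‖) := (l2_opNorm_mul _ _).trans (by gcongr; exact l2_opNorm_mul _ _)
      _ ≤ 1 * (1 * 1) := by gcongr
      _ = 1 := by norm_num
  have hpp1 : ∀ {f : Matrix (Fin n) (Fin l) ℝ}, ‖p * f‖ ≤ 1 → ‖p * p * f‖ ≤ 1 := by
    intro f hf
    rw [Matrix.mul_assoc]
    calc _ ≤ ‖p‖ * ‖p * f‖ := l2_opNorm_mul _ _
      _ ≤ 1 * 1 := by gcongr
      _ = 1 := one_mul 1
  have hHHpp : ‖H * H - p * p‖ ≤ 4 * ε₁ := by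
    rw [show H * H - p * p = H * (H - p) + (H - p) * p by noncomm_ring]
    calc _ ≤ ‖H‖ * ‖H - p‖ + ‖H - p‖ * ‖p‖ :=
          (norm_add_le _ _).trans (add_le_add (norm_mul_le _ _) (norm_mul_le _ _))
      _ ≤ 1 * (2 * ε₁) + 2 * ε₁ * 1 := by gcongr
      _ = _ := by ring
  have hHQH : ‖H - H * H * Q * (H * H)‖ ≤ 10 * B ^ 4 * ε₁ := by
    have h1 := norm_bilin_sub_le Q (H * H) (p * p) (H * H) (p * p)
    rw [transpose_mul, transpose_mul, hHt, hpt, hpQp] at h1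
    have h2 : ‖H * H‖ ≤ 1 * 1 := (norm_mul_le _ _).trans (by gcongr)
    have h3 : ‖p * p‖ ≤ 1 * 1 := (norm_mul_le _ _).trans (by gcongr)
    have hB4 : 1 ≤ B ^ 4 := one_le_pow₀ hB
    calc ‖H - H * H * Q * (H * H)‖ = ‖(H - p) - (H * H * Q * (H * H) - p)‖ := by congr 1; abel
      _ ≤ 2 * ε₁ + (4 * ε₁ * B ^ 4 * (1 * 1) + (1 * 1) * B ^ 4 * (4 * ε₁)) := by
          refine (norm_sub_le _ _).trans (add_le_add hHp (h1.trans ?_))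
          gcongr
      _ ≤ _ := by nlinarith
  have hsplit : fᵀ * H * g - fᵀ * p * g =
      (H * H * f)ᵀ * (J * (H - H * H * Q * (H * H)) * J) * (H * H * g) +
        ((H * H * f)ᵀ * Q * (H * H * g) - (p * p * f)ᵀ * Q * (p * p * g)) := by
    have e1 : (H * H * f)ᵀ = fᵀ * (H * H) := by
      rw [transpose_mul, transpose_mul, hHt]
    have e2 : (p * p * f)ᵀ = fᵀ * (p * p) := by
      rw [transpose_mul, transpose_mul, hpt]
    have e3 : H * H * (J * (H - H * H * Q * (H * H)) * J) * (H * H) = H - H * H * Q * (H * H) := by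
      calc _ = (H * H * J) * (H - H * H * Q * (H * H)) * (J * (H * H)) := by
            simp only [Matrix.mul_assoc]
        _ = (Pr * H) * Pr - (Pr * H) * H * Q * (H * (H * Pr)) := by
            rw [hHHJ, hJHH]
            simp only [Matrix.mul_sub, Matrix.sub_mul, Matrix.mul_assoc]
        _ = _ := by rw [hPrH, hHPr]
    have e4 : fᵀ * (H * H) * (J * (H - H * H * Q * (H * H)) * J) * (H * H * g) =
        fᵀ * (H - H * H * Q * (H * H)) * g := by
      calc _ = fᵀ * (H * H * (J * (H - H * H * Q * (H * H)) * J) * (H * H)) * g := by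
            simp only [Matrix.mul_assoc]
        _ = _ := by rw [e3]
    have e5 : fᵀ * (p * p) * Q * (p * p * g) = fᵀ * p * g := by
      conv_rhs => rw [← hpQp]
      simp only [Matrix.mul_assoc]
    rw [e1, e2, e4, e5]
    simp only [Matrix.mul_sub, Matrix.sub_mul, Matrix.mul_assoc]
    abel
  have hB8 : B ^ 4 ≤ B ^ 8 := pow_le_pow_right₀ hB (by norm_num)
  have hfirst : ‖(H * H * f)ᵀ * (J * (H - H * H * Q * (H * H)) * J) * (H * H * g)‖ ≤
      1 * (4 * B ^ 2 * (10 * B ^ 4 * ε₁) * (4 * B ^ 2)) * 1 := by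
    refine (l2_opNorm_mul _ _).trans (mul_le_mul ?_ (hHH1 hg) (norm_nonneg _) (by positivity))
    refine (l2_opNorm_mul _ _).trans
      (mul_le_mul ?_ ?_ (norm_nonneg _) zero_le_one)
    · rw [l2_opNorm_transpose]; exact hHH1 hf
    · refine (norm_mul_le _ _).trans (mul_le_mul ?_ hJB (norm_nonneg _) (by positivity))
      exact (norm_mul_le _ _).trans (mul_le_mul hJB hHQH (norm_nonneg _) (by positivity))
  have hsecond : ‖(H * H * f)ᵀ * Q * (H * H * g) - (p * p * f)ᵀ * Q * (p * p * g)‖ ≤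
      4 * ε₁ * B ^ 4 * 1 + 1 * B ^ 4 * (4 * ε₁) := by
    have := hHHp hf hfε
    have := hHHp hg hgε
    have := hHH1 hg
    have := hpp1 hf'
    refine (norm_bilin_sub_le _ _ _ _ _).trans ?_
    gcongr
  rw [hsplit]
  have hlast : B ^ 4 * ε₁ ≤ B ^ 8 * ε₁ := by gcongr
  calc _ ≤ _ := (norm_add_le _ _).trans (add_le_add hfirst hsecond)
    _ = 160 * (B ^ 8 * ε₁) + 8 * (B ^ 4 * ε₁) := by ring
    _ ≤ 168 * B ^ 8 * ε₁ := by linarith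

end Perturbation

/-! ### Gram matrix of the adjacency spectral embedding -/

section Gram

open scoped Matrix.Norms.L2Operator
open Matrix

variable {n D : ℕ}

theorem sum_ite_lt (hD : D ≤ n) (φ : Fin n → ℝ) :
    ∑ i : Fin n, (if i.val < D then φ i else 0) = ∑ k : Fin D, φ (Fin.castLE hD k) := by
  obtain ⟨r, rfl⟩ := Nat.exists_eq_add_of_le hD
  rw [Fin.sum_univ_add]
  simp [Fin.castLE, Fin.castAdd]

theorem conjDiag_apply (U : Matrix (Fin n) (Fin n) ℝ) (d : Fin n → ℝ) (u v : Fin n) :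
    conjDiag U d u v = ∑ i, d i * (U u i * U v i) := by
  rw [conjDiag, Matrix.mul_apply]
  exact Finset.sum_congr rfl fun i _ => by rw [mul_diagonal, transpose_apply]; ring

/-- The Gram matrix of an adjacency spectral embedding is the spectral truncation of `|A|`. -/
theorem IsASE.exists_spectral {A : Matrix (Fin n) (Fin n) ℝ} (hA : Aᵀ = A)
    {Xhat : Fin n → EuclideanSpace ℝ (Fin D)} (h : IsASE A Xhat) {c : ℝ} (hc : 0 ≤ c) :
    ∃ (a U : Matrix (Fin n) (Fin n) ℝ) (s : Fin n → ℝ), a.PosSemidef ∧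
      a * a = (c • A) * (c • A) ∧ U ∈ orthogonalGroup (Fin n) ℝ ∧ Antitone s ∧
      a = conjDiag U s ∧ (∀ i, 0 ≤ s i) ∧
      ∀ u v, c * inner ℝ (Xhat u) (Xhat v) = conjDiag U (trunc D s) u v := by
  obtain ⟨hD, absA, U, s, hpsd, hsq, hU, hs, habs, hX⟩ := h
  have hUU : Uᵀ * U = 1 := (mem_orthogonalGroup_iff' (Fin n) ℝ).1 hU
  have hs0 : ∀ i, 0 ≤ s i := fun i => by
    have h1 := hpsd.conjTranspose_mul_mul_same U
    have h2 : Uᵀ * absA * U = diagonal s := by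
      calc _ = (Uᵀ * U) * diagonal s * (Uᵀ * U) := by rw [habs]; simp only [Matrix.mul_assoc]
        _ = _ := by rw [hUU, Matrix.one_mul, Matrix.mul_one]
    rw [conjTranspose_eq_transpose_of_trivial, h2] at h1
    simpa using h1.diag_nonneg (i := i)
  refine ⟨c • absA, U, fun i => c * s i, hpsd.smul hc, ?_, hU,
    fun i j hij => mul_le_mul_of_nonneg_left (hs hij) hc, ?_, fun i => mul_nonneg hc (hs0 i), ?_⟩
  · rw [Matrix.smul_mul, Matrix.mul_smul, hsq, hA, Matrix.smul_mul, Matrix.mul_smul]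
  · rw [conjDiag, show diagonal (fun i => c * s i) = c • diagonal s from
      diagonal_smul c s,
      Matrix.mul_smul, Matrix.smul_mul, ← habs]
  · intro u v
    rw [conjDiag_apply]
    simp only [trunc, ite_mul, zero_mul]
    rw [sum_ite_lt hD, PiLp.inner_apply, Finset.mul_sum]
    refine Finset.sum_congr rfl fun k _ => ?_
    simp only [hX, RCLike.inner_apply, conj_trivial]
    have := Real.mul_self_sqrt (hs0 (Fin.castLE hD k))
    linear_combination c * U v (Fin.castLE hD k) * U u (Fin.castLE hD k) * this

/-- A symmetric matrix with entries in `[-1, 1]` has small operator norm if the inner products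
of distinct rows are small. -/
theorem l2_opNorm_le_of_codegree {E : Matrix (Fin n) (Fin n) ℝ} (hE : Eᵀ = E)
    (hE1 : ∀ u v, |E u v| ≤ 1) {η ε : ℝ} (hη1 : η ≤ 1) (hn : 1 ≤ η * n)
    (hε : 0 ≤ ε) (hηε : 2 * η ≤ ε ^ 4)
    (h : ∀ u w, u ≠ w → |∑ v, E u v * E v w| ≤ η * n) : ‖E‖ ≤ ε * n := by
  have hn0 : (0 : ℝ) ≤ n := n.cast_nonneg
  have hη0 : 0 ≤ η := by
    by_contra hneg
    nlinarith
  have h1 : ‖E * E‖ ≤ (ε * n) ^ 2 := by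
    refine l2_opNorm_le_of_sum_sq_le (by positivity) ?_
    have hrow : ∀ u, ∑ w, (E * E) u w ^ 2 ≤ (n : ℝ) ^ 2 + n * (η * n) ^ 2 := fun u => by
      have hdiag : |(E * E) u u| ≤ n := by
        rw [Matrix.mul_apply]
        calc _ ≤ ∑ v, |E u v * E v u| := Finset.abs_sum_le_sum_abs _ _
          _ ≤ ∑ v : Fin n, (1 : ℝ) := Finset.sum_le_sum fun v _ => by
              rw [abs_mul]
              exact mul_le_one₀ (hE1 _ _) (abs_nonneg _) (hE1 _ _)
          _ = n := by simp
      calc _ ≤ ∑ w, ((if w = u then (n : ℝ) ^ 2 else 0) + (η * n) ^ 2) := by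
            refine Finset.sum_le_sum fun w _ => ?_
            by_cases hwu : w = u
            · subst hwu
              rw [if_pos rfl, ← sq_abs]
              have : |(E * E) w w| ^ 2 ≤ (n : ℝ) ^ 2 := by gcongr
              nlinarith [sq_nonneg (η * n)]
            · rw [if_neg hwu, zero_add, ← sq_abs, Matrix.mul_apply]
              have := h u w (Ne.symm hwu)
              gcongr
        _ = _ := by simp [Finset.sum_add_distrib]
    calc _ ≤ ∑ _u : Fin n, ((n : ℝ) ^ 2 + n * (η * n) ^ 2) := Finset.sum_le_sum fun u _ => hrow u
      _ = n ^ 3 * (1 + (η * η) * n) := by simp; ring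
      _ ≤ n ^ 3 * (η * n + η * 1 * n) := by gcongr
      _ = 2 * η * n ^ 4 := by ring
      _ ≤ ε ^ 4 * n ^ 4 := by gcongr
      _ = _ := by ring
  have h2 := l2_opNorm_transpose_mul_self E
  rw [hE] at h2
  exact abs_le_of_sq_le_sq' (by rw [pow_two, ← h2]; exact h1) (by positivity) |>.2

/-- The error matrix `A - X Xᵀ` of a random dot product graph. -/
noncomputable def noise (A : Matrix (Fin n) (Fin n) ℝ) (x : Fin n → EuclideanSpace ℝ (Fin D)) :
    Matrix (Fin n) (Fin n) ℝ :=
  Matrix.of fun u v => A u v - inner ℝ (x u) (x v)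

/-- The empirical second moment matrix. -/
noncomputable def empiricalMoment (x : Fin n → EuclideanSpace ℝ (Fin D)) : Matrix (Fin D) (Fin D) ℝ :=
  Matrix.of fun a b => (n : ℝ)⁻¹ * ∑ v, x v a * x v b

/-- Deterministic consistency of the adjacency spectral embedding: if the noise is quasirandom and
nearly orthogonal to the latent positions, then the Gram matrix of every embedding is entrywise
close to that of the latent positions. -/
theorem IsASE.abs_inner_sub_le {A : Matrix (Fin n) (Fin n) ℝ} (hA : Aᵀ = A)
    (hA1 : ∀ u v, A u v ∈ Set.Icc (0 : ℝ) 1)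
    {x : Fin n → EuclideanSpace ℝ (Fin D)} (hx : ∀ u v, inner ℝ (x u) (x v) ∈ Set.Icc (0 : ℝ) 1)
    {C' : Matrix (Fin D) (Fin D) ℝ} {B η ε ε₁ : ℝ}
    (hC : C' * empiricalMoment x = 1) (hC' : empiricalMoment x * C' = 1)
    (hB : 1 ≤ B) (hCB : ‖C'‖ ≤ B)
    (hη1 : η ≤ 1) (hn : 1 ≤ η * n) (hε0 : 0 ≤ ε) (hηε : 2 * η ≤ ε ^ 4) (hηD : D * η ^ 2 ≤ ε ^ 2)
    (hε₁ : 0 ≤ ε₁) (hεε₁ : ε ≤ ε₁) (h2ε : 2 * ε ≤ ε₁ ^ 2) (hεB : 2 * B * ε₁ ≤ 1)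
    (hdeg : ∀ u w, u ≠ w → |∑ v, noise A x u v * noise A x v w| ≤ η * n)
    (horth : ∀ u k, |∑ w, noise A x u w * x w k| ≤ η * n)
    {Xhat : Fin n → EuclideanSpace ℝ (Fin D)} (h : IsASE A Xhat) (u v : Fin n) :
    |inner ℝ (Xhat u) (Xhat v) - inner ℝ (x u) (x v)| ≤ 168 * B ^ 8 * ε₁ := by
  have hn0 : (0 : ℝ) < n := by
    rcases Nat.eq_zero_or_pos n with rfl | h0
    · exact u.elim0
    · exact_mod_cast h0
  set r := √(n : ℝ) with hr
  have hr0 : 0 < r := Real.sqrt_pos.2 hn0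
  have hrr : r * r = n := Real.mul_self_sqrt hn0.le
  obtain ⟨a, U, s, hapsd, haa, hU, hs, haU, hs0, hXhat⟩ :=
    h.exists_spectral hA (inv_nonneg.2 hn0.le)
  set α := (n : ℝ)⁻¹ • A with hα
  let Y : Matrix (Fin n) (Fin D) ℝ := Matrix.of fun v k => r⁻¹ * x v k
  have hinner : ∀ u v, inner ℝ (x u) (x v) = ∑ k, x u k * x v k := fun u v => by
    rw [PiLp.inner_apply]
    exact Finset.sum_congr rfl fun k _ => by simp [mul_comm]
  have hp : ∀ u v, (Y * Yᵀ) u v = (n : ℝ)⁻¹ * inner ℝ (x u) (x v) := fun u v => by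
    rw [Matrix.mul_apply, hinner, Finset.mul_sum]
    refine Finset.sum_congr rfl fun k _ => ?_
    simp only [Y, Matrix.of_apply, transpose_apply, ← hrr]
    field_simp
  have hYY : Yᵀ * Y = empiricalMoment x := by
    ext i j
    simp only [Matrix.mul_apply, empiricalMoment, Matrix.of_apply, Finset.mul_sum]
    refine Finset.sum_congr rfl fun k _ => ?_
    simp only [Y, Matrix.of_apply, transpose_apply, ← hrr]
    field_simp
  have hE : α - Y * Yᵀ = (n : ℝ)⁻¹ • noise A x := by
    ext i j
    rw [Matrix.sub_apply, hp, hα, Matrix.smul_apply, Matrix.smul_apply, noise, Matrix.of_apply,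
      smul_eq_mul, smul_eq_mul]
    ring
  have hnoise1 : ∀ u v, |noise A x u v| ≤ 1 := fun u v => by
    have h1 := hA1 u v
    have h2 := hx u v
    rw [noise, Matrix.of_apply, abs_le]
    exact ⟨by linarith [h1.1, h2.2], by linarith [h1.2, h2.1]⟩
  have hnoiseT : (noise A x)ᵀ = noise A x := by
    ext i j
    rw [transpose_apply, noise, Matrix.of_apply, Matrix.of_apply, real_inner_comm,
      ← congrFun (congrFun hA i) j, transpose_apply]
  have hαE : ‖α - Y * Yᵀ‖ ≤ ε := by
    rw [hE, norm_smul, norm_inv, Real.norm_of_nonneg hn0.le, inv_mul_le_iff₀ hn0, mul_comm]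
    exact l2_opNorm_le_of_codegree hnoiseT hnoise1 hη1 hn hε0 hηε hdeg
  have hsq1 : ∀ {t : ℝ}, t ∈ Set.Icc (0 : ℝ) 1 → t ^ 2 ≤ 1 := fun ht =>
    pow_le_one₀ ht.1 ht.2
  have hα1 : ‖α‖ ≤ 1 := by
    rw [hα, norm_smul, norm_inv, Real.norm_of_nonneg hn0.le, inv_mul_le_iff₀ hn0, mul_one]
    refine l2_opNorm_le_of_sum_sq_le hn0.le ?_
    calc _ ≤ ∑ _i : Fin n, ∑ _j : Fin n, (1 : ℝ) :=
          Finset.sum_le_sum fun i _ => Finset.sum_le_sum fun j _ => hsq1 (hA1 i j)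
      _ = _ := by simp; ring
  have hY1 : ‖Y‖ ≤ 1 := by
    refine l2_opNorm_le_of_sum_sq_le zero_le_one ?_
    calc _ = ∑ v, (n : ℝ)⁻¹ * inner ℝ (x v) (x v) := by
          refine Finset.sum_congr rfl fun v _ => ?_
          rw [← hp, Matrix.mul_apply]
          exact Finset.sum_congr rfl fun k _ => by rw [transpose_apply]; ring
      _ ≤ ∑ _v : Fin n, (n : ℝ)⁻¹ * 1 := Finset.sum_le_sum fun v _ => by
          have := (hx v v).2
          gcongr
      _ = 1 ^ 2 := by simp [hn0.ne']
  let f : Fin n → Matrix (Fin n) (Fin 1) ℝ := fun u => Matrix.of fun i _ => if i = u then r else 0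
  have hmulf : ∀ {m : ℕ} (M : Matrix (Fin m) (Fin n) ℝ) u i j, (M * f u) i j = M i u * r :=
    fun M u i j => by simp [Matrix.mul_apply, f]
  have hcol : ∀ (M : Matrix (Fin n) (Fin n) ℝ), (∀ i j, (n * M i j) ^ 2 ≤ 1) → ∀ u,
      ‖M * f u‖ ≤ 1 := fun M hM u => by
    refine l2_opNorm_le_of_sum_sq_le zero_le_one ?_
    calc _ = ∑ i, (n : ℝ)⁻¹ * (n * M i u) ^ 2 := by
          refine Finset.sum_congr rfl fun i _ => ?_
          simp only [hmulf, Finset.sum_const, Finset.card_univ, Fintype.card_fin, one_smul, ← hrr]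
          field_simp
      _ ≤ ∑ _i : Fin n, (n : ℝ)⁻¹ * 1 := Finset.sum_le_sum fun i _ => by
          have := hM i u
          gcongr
      _ = 1 ^ 2 := by simp [hn0.ne']
  have hαf : ∀ u, ‖α * f u‖ ≤ 1 := hcol α fun i j => by
    rw [hα, Matrix.smul_apply, smul_eq_mul, mul_inv_cancel_left₀ hn0.ne']
    exact hsq1 (hA1 i j)
  have hpf : ∀ u, ‖Y * Yᵀ * f u‖ ≤ 1 := hcol _ fun i j => by
    rw [hp, mul_inv_cancel_left₀ hn0.ne']
    exact hsq1 (hx i j)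
  have hEf : ∀ u, ‖Yᵀ * ((α - Y * Yᵀ) * f u)‖ ≤ ε := fun u => by
    refine l2_opNorm_le_of_sum_sq_le hε0 (le_trans ?_ hηD)
    have hk : ∀ k j, (Yᵀ * ((α - Y * Yᵀ) * f u)) k j ^ 2 ≤ η ^ 2 := fun k j => by
      have h1 : (Yᵀ * ((α - Y * Yᵀ) * f u)) k j = (n : ℝ)⁻¹ * ∑ w, noise A x u w * x w k := by
        rw [Matrix.mul_apply, Finset.mul_sum]
        refine Finset.sum_congr rfl fun w _ => ?_
        rw [hmulf, hE, ← congrFun (congrFun hnoiseT u) w, transpose_apply, transpose_apply,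
          Matrix.smul_apply, smul_eq_mul]
        simp only [Y, Matrix.of_apply]
        field_simp
      rw [h1, ← sq_abs, abs_mul, abs_of_pos (inv_pos.2 hn0)]
      have h2 := horth u k
      have h3 : (n : ℝ)⁻¹ * |∑ w, noise A x u w * x w k| ≤ η := by
        rw [inv_mul_le_iff₀ hn0, mul_comm]
        exact h2
      gcongr
    calc _ ≤ ∑ _k : Fin D, ∑ _j : Fin 1, η ^ 2 :=
          Finset.sum_le_sum fun k _ => Finset.sum_le_sum fun j _ => hk k j
      _ = _ := by simp
  have hmain := norm_trunc_sub_le hapsd haa hU hs haU hs0 hα1 hY1 (by rw [hYY]; exact hC)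
    (by rw [hYY]; exact hC') hB hCB hαE hε₁ hεε₁ h2ε hεB (hαf u) (hpf u) (hEf u) (hαf v) (hEf v)
  refine le_trans (le_of_eq ?_) ((abs_entry_le_l2_opNorm _ 0 0).trans hmain)
  have hfm : ∀ M : Matrix (Fin n) (Fin n) ℝ, ((f u)ᵀ * M * f v) 0 0 = n * M u v := fun M => by
    rw [hmulf, Matrix.mul_apply]
    simp only [transpose_apply, f, Matrix.of_apply, ite_mul, zero_mul, Finset.sum_ite_eq',
      Finset.mem_univ, if_true, ← hrr]
    ring
  rw [Matrix.sub_apply, hfm, hfm, hp, ← hXhat, mul_inv_cancel_left₀ hn0.ne',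
    mul_inv_cancel_left₀ hn0.ne']

end Gram

/-! ### Concentration -/

section Concentration

variable {Ω : Type*} [MeasurableSpace Ω] {μ : Measure Ω}

/-- Two-sided Hoeffding inequality for centered variables with values in `[-1, 1]`. -/
theorem measure_abs_sum_ge_le [IsProbabilityMeasure μ] {n : ℕ} {Y : Fin n → Ω → ℝ}
    (hind : iIndepFun Y μ) (hm : ∀ i, Measurable (Y i)) (hb : ∀ i, ∀ᵐ ω ∂μ, |Y i ω| ≤ 1)
    (h0 : ∀ i, ∫ ω, Y i ω ∂μ = 0) {ε : ℝ} (hε : 0 ≤ ε) :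
    μ {ω | ε * n ≤ |∑ i, Y i ω|} ≤ ENNReal.ofReal (2 * Real.exp (-(ε ^ 2 / 2 * n))) := by
  have one_sided : ∀ Z : Fin n → Ω → ℝ, iIndepFun Z μ → (∀ i, Measurable (Z i)) →
      (∀ i, ∀ᵐ ω ∂μ, |Z i ω| ≤ 1) → (∀ i, ∫ ω, Z i ω ∂μ = 0) →
      μ.real {ω | ε * n ≤ ∑ i, Z i ω} ≤ Real.exp (-(ε ^ 2 / 2 * n)) := by
    intro Z hind hm hb h0
    have hsub : ∀ i ∈ Finset.univ, HasSubgaussianMGF (Z i) 1 μ := fun i _ => by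
      have := hasSubgaussianMGF_of_mem_Icc_of_integral_eq_zero (a := -1) (b := 1)
        (hm i).aemeasurable ((hb i).mono fun ω h => abs_le.1 h) (h0 i)
      have e : ((‖(1 : ℝ) - -1‖₊ / 2) ^ 2 : NNReal) = 1 := by
        rw [show (1 : ℝ) - -1 = 2 by norm_num]
        simp
      rwa [e] at this
    refine (HasSubgaussianMGF.measure_sum_ge_le_of_iIndepFun hind hsub (ε := ε * n)
      (by positivity)).trans (le_of_eq ?_)
    congr 1
    rcases Nat.eq_zero_or_pos n with rfl | hn
    · simp
    · have : (n : ℝ) ≠ 0 := by positivity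
      simp
      field_simp
  have hpos := one_sided Y hind hm hb h0
  have hneg := one_sided (fun i ω => -Y i ω) (hind.comp (fun _ => Neg.neg) fun _ => measurable_neg)
    (fun i => (hm i).neg) (by simpa using hb) (fun i => by rw [integral_neg, h0 i, neg_zero])
  have hsub : {ω | ε * n ≤ |∑ i, Y i ω|} ⊆
      {ω | ε * n ≤ ∑ i, Y i ω} ∪ {ω | ε * n ≤ ∑ i, -Y i ω} := fun ω hω => by
    simpa [le_abs] using hω
  rw [← ofReal_measureReal]
  refine ENNReal.ofReal_le_ofReal ?_
  calc _ ≤ _ := measureReal_mono hsub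
    _ ≤ _ := measureReal_union_le _ _
    _ ≤ _ := by linarith

/-- An event depending on independent variables `A` and `B` is unlikely if it is unlikely for each
fixed value of `A`. -/
theorem measure_mem_le_of_indepFun [IsProbabilityMeasure μ] {α β : Type*} [Fintype α]
    [MeasurableSpace α] [MeasurableSingletonClass α] [MeasurableSpace β] {A : Ω → α} {B : Ω → β}
    (hA : Measurable A) (hind : IndepFun A B μ) {Q : α → Set β}
    (hQ : ∀ a, MeasurableSet (Q a)) {δ : ENNReal} (h : ∀ a, μ (B ⁻¹' Q a) ≤ δ) :
    μ {ω | B ω ∈ Q (A ω)} ≤ δ := by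
  have hsub : {ω | B ω ∈ Q (A ω)} ⊆ ⋃ a ∈ (Finset.univ : Finset α), A ⁻¹' {a} ∩ B ⁻¹' Q a :=
    fun ω hω => by simpa using hω
  calc _ ≤ _ := measure_mono hsub
    _ ≤ ∑ a, μ (A ⁻¹' {a} ∩ B ⁻¹' Q a) := measure_biUnion_finset_le _ _
    _ = ∑ a, μ (A ⁻¹' {a}) * μ (B ⁻¹' Q a) := Finset.sum_congr rfl fun a _ =>
        hind.measure_inter_preimage_eq_mul _ _ (measurableSet_singleton a) (hQ a)
    _ ≤ ∑ a, μ (A ⁻¹' {a}) * δ := by gcongr with a; exact h a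
    _ = δ := by
        rw [← Finset.sum_mul, sum_measure_preimage_singleton _ fun a _ =>
          hA (measurableSet_singleton a)]
        simp

end Concentration

/-! ### Graphs with independent edges as functions of independent bits -/

section EdgeMeasure

variable {n D : ℕ}

/-- The law on `Bool` with mass `p` at `true` and mass `1 - p` at `false`. -/
noncomputable def boolMeasure (p : ℝ) : Measure Bool :=
  ENNReal.ofReal p • Measure.dirac true + ENNReal.ofReal (1 - p) • Measure.dirac false

instance (p : ℝ) : IsFiniteMeasure (boolMeasure p) := by
  constructor
  simp [boolMeasure]

theorem isProbabilityMeasure_boolMeasure {p : ℝ} (hp : p ∈ Set.Icc (0 : ℝ) 1) :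
    IsProbabilityMeasure (boolMeasure p) := by
  constructor
  simp [boolMeasure]
  rw [← ENNReal.ofReal_add hp.1 (by linarith [hp.2])]
  simp

theorem integral_boolMeasure {p : ℝ} (hp : p ∈ Set.Icc (0 : ℝ) 1) (f : Bool → ℝ) :
    ∫ b, f b ∂boolMeasure p = p * f true + (1 - p) * f false := by
  rw [boolMeasure, integral_add_measure
    (Integrable.of_finite.smul_measure ENNReal.ofReal_ne_top)
    (Integrable.of_finite.smul_measure ENNReal.ofReal_ne_top), integral_smul_measure,
    integral_smul_measure, integral_dirac, integral_dirac, ENNReal.toReal_ofReal hp.1,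
    ENNReal.toReal_ofReal (by linarith [hp.2])]
  rfl

/-- Independent bits with success probabilities `⟨x u, x v⟩`, one for every ordered pair. -/
noncomputable def edgeMeasure (x : Fin n → EuclideanSpace ℝ (Fin D)) :
    Measure (Fin n × Fin n → Bool) :=
  Measure.pi fun e => boolMeasure (inner ℝ (x e.1) (x e.2))

/-- The ordered pair representing an edge. -/
def edge (u v : Fin n) : Fin n × Fin n := (min u v, max u v)

theorem edge_comm (u v : Fin n) : edge u v = edge v u := by
  rw [edge, edge, min_comm, max_comm]

theorem edge_of_lt {u v : Fin n} (h : u < v) : edge u v = (u, v) := by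
  rw [edge, min_eq_left h.le, max_eq_right h.le]

theorem edge_eq_iff {u v w z : Fin n} :
    edge u v = edge w z ↔ (u = w ∧ v = z) ∨ (u = z ∧ v = w) := by
  simp only [edge, Prod.mk.injEq]
  grind

/-- The graph whose edges are given by the bits of the pairs `u < v`. -/
def graphOfBits (b : Fin n × Fin n → Bool) : SimpleGraph (Fin n) where
  Adj u v := u ≠ v ∧ b (edge u v) = true
  symm := ⟨fun u v h => ⟨h.1.symm, by rw [edge_comm]; exact h.2⟩⟩
  loopless := ⟨fun _ h => h.1 rfl⟩

variable {x : Fin n → EuclideanSpace ℝ (Fin D)}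

theorem isProbabilityMeasure_edgeMeasure
    (hx : ∀ u v, inner ℝ (x u) (x v) ∈ Set.Icc (0 : ℝ) 1) :
    IsProbabilityMeasure (edgeMeasure x) := by
  have := fun e : Fin n × Fin n => isProbabilityMeasure_boolMeasure (hx e.1 e.2)
  unfold edgeMeasure
  infer_instance

theorem edgeMeasure_graphOfBits_eq (hx : ∀ u v, inner ℝ (x u) (x v) ∈ Set.Icc (0 : ℝ) 1)
    (g : SimpleGraph (Fin n)) :
    edgeMeasure x {b | graphOfBits b = g} = ENNReal.ofReal (edgeLikelihood x g) := by
  classical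
  have hset : {b | graphOfBits b = g} = Set.univ.pi fun e : Fin n × Fin n =>
      if e.1 < e.2 then {decide (g.Adj e.1 e.2)} else Set.univ := by
    ext b
    simp only [Set.mem_ofPred_eq, Set.mem_univ_pi]
    constructor
    · rintro rfl ⟨u, v⟩
      split_ifs with h
      · have h' : u < v := h
        simp [graphOfBits, edge_of_lt h', h'.ne]
      · trivial
    · intro h
      have key : ∀ u v, u < v → ((graphOfBits b).Adj u v ↔ g.Adj u v) := fun u v huv => by
        have := h (u, v)
        rw [if_pos huv, Set.mem_singleton_iff] at this
        simp [graphOfBits, edge_of_lt huv, this, huv.ne]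
      ext u v
      rcases lt_trichotomy u v with huv | rfl | huv
      · exact key u v huv
      · simp
      · rw [SimpleGraph.adj_comm, key v u huv, SimpleGraph.adj_comm]
  rw [hset, edgeMeasure, Measure.pi_pi, edgeLikelihood, Fintype.prod_prod_type,
    ENNReal.ofReal_prod_of_nonneg]
  · refine Finset.prod_congr rfl fun u _ => ?_
    rw [ENNReal.ofReal_prod_of_nonneg]
    · rw [← Finset.prod_subset (Finset.subset_univ (Finset.Ioi u))]
      · refine Finset.prod_congr rfl fun v hv => ?_
        rw [if_pos (Finset.mem_Ioi.1 hv)]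
        by_cases hg : g.Adj u v <;> simp [hg, boolMeasure]
      · intro v _ hv
        have := isProbabilityMeasure_boolMeasure (hx u v)
        rw [if_neg (by simpa using hv), measure_univ]
    · intro v _
      have := hx u v
      split_ifs <;> linarith [this.1, this.2]
  · intro u _
    refine Finset.prod_nonneg fun v _ => ?_
    have := hx u v
    split_ifs <;> linarith [this.1, this.2]

/-- The centered bit of the edge `{u, v}`. -/
noncomputable def centeredBit (x : Fin n → EuclideanSpace ℝ (Fin D)) (u v : Fin n) (b : Bool) : ℝ :=
  (if b then 1 else 0) - inner ℝ (x u) (x v)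

theorem abs_centeredBit_le (hx : ∀ u v, inner ℝ (x u) (x v) ∈ Set.Icc (0 : ℝ) 1) (u v : Fin n)
    (b : Bool) : |centeredBit x u v b| ≤ 1 := by
  have := hx u v
  unfold centeredBit
  rw [abs_le]
  split_ifs <;> constructor <;> linarith [this.1, this.2]

theorem integral_centeredBit (hx : ∀ u v, inner ℝ (x u) (x v) ∈ Set.Icc (0 : ℝ) 1) (u v : Fin n) :
    ∫ b, centeredBit x u v (b (edge u v)) ∂edgeMeasure x = 0 := by
  have := fun e : Fin n × Fin n => isProbabilityMeasure_boolMeasure (hx e.1 e.2)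
  have hsym : inner ℝ (x (edge u v).1) (x (edge u v).2) = inner ℝ (x u) (x v) := by
    rcases le_total u v with h | h
    · simp [edge, h]
    · simp [edge, h, real_inner_comm]
  have h1 := integral_comp_eval (X := fun _ : Fin n × Fin n => Bool)
    (μ := fun e => boolMeasure (inner ℝ (x e.1) (x e.2))) (i := edge u v) (f := centeredBit x u v)
    (measurable_of_finite _).aestronglyMeasurable
  rw [edgeMeasure, h1, integral_boolMeasure (hx _ _), hsym]
  simp only [centeredBit, if_true, Bool.false_eq_true, if_false]
  ring

theorem iIndepFun_bits (hx : ∀ u v, inner ℝ (x u) (x v) ∈ Set.Icc (0 : ℝ) 1) :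
    iIndepFun (fun (e : Fin n × Fin n) (b : Fin n × Fin n → Bool) => b e) (edgeMeasure x) := by
  have := fun e : Fin n × Fin n => isProbabilityMeasure_boolMeasure (hx e.1 e.2)
  exact iIndepFun_pi (X := fun _ => id) fun _ => measurable_id.aemeasurable

theorem edge_injective (u : Fin n) : Function.Injective (edge u) := fun v w h => by
  rcases edge_eq_iff.1 h with h | h
  · exact h.2
  · exact h.2.trans h.1

/-- Hoeffding's inequality for weighted sums of the centered bits at a vertex. -/
theorem edgeMeasure_abs_sum_ge_le (hx : ∀ u v, inner ℝ (x u) (x v) ∈ Set.Icc (0 : ℝ) 1)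
    (u : Fin n) {c : Fin n → ℝ} (hc : ∀ v, |c v| ≤ 1) {ε : ℝ} (hε : 0 ≤ ε) :
    edgeMeasure x {b | ε * n ≤ |∑ v, c v * centeredBit x u v (b (edge u v))|} ≤
      ENNReal.ofReal (2 * Real.exp (-(ε ^ 2 / 2 * n))) := by
  have := isProbabilityMeasure_edgeMeasure hx
  have hind := ((iIndepFun_bits hx).precomp (edge_injective u)).comp
    (fun v b => c v * centeredBit x u v b) fun v => measurable_of_finite _
  refine measure_abs_sum_ge_le hind (fun v => measurable_of_finite _)
    (fun v => Filter.Eventually.of_forall fun b => ?_) (fun v => ?_) hε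
  · simp only [Function.comp_apply, abs_mul]
    exact mul_le_one₀ (hc v) (abs_nonneg _) (abs_centeredBit_le hx u v _)
  · simp only [Function.comp_apply]
    rw [integral_const_mul, integral_centeredBit hx, mul_zero]

/-- Concentration of the inner product of two distinct rows of centered bits. -/
theorem edgeMeasure_abs_sum_mul_ge_le (hx : ∀ u v, inner ℝ (x u) (x v) ∈ Set.Icc (0 : ℝ) 1)
    {u w : Fin n} (huw : u ≠ w) {ε : ℝ} (hε : 0 ≤ ε) :
    edgeMeasure x {b | ε * n ≤ |∑ v, if v ≠ u ∧ v ≠ w then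
        centeredBit x u v (b (edge u v)) * centeredBit x w v (b (edge w v)) else 0|} ≤
      ENNReal.ofReal (2 * Real.exp (-(ε ^ 2 / 2 * n))) := by
  classical
  have := isProbabilityMeasure_edgeMeasure hx
  let V : Finset (Fin n) := {v | v ≠ u ∧ v ≠ w}
  have hV : ∀ {v}, v ≠ u ∧ v ≠ w → v ∈ V := fun h => by simpa [V] using h
  let S : Fin n → Finset (Fin n × Fin n) := fun z => V.image (edge z)
  have hST : Disjoint (S u) (S w) := by
    rw [Finset.disjoint_left]
    intro e h1 h2
    obtain ⟨v, hv, rfl⟩ := Finset.mem_image.1 h1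
    obtain ⟨v', hv', he⟩ := Finset.mem_image.1 h2
    simp only [V, Finset.mem_filter, Finset.mem_univ, true_and] at hv hv'
    rcases edge_eq_iff.1 he with h | h
    · exact huw h.1.symm
    · exact hv.2 h.1.symm
  let φ : ∀ z, (S z → Bool) → Fin n → Bool := fun z r v =>
    if h : v ≠ u ∧ v ≠ w then r ⟨edge z v, Finset.mem_image_of_mem _ (hV h)⟩ else false
  have hind := ((iIndepFun_bits hx).indepFun_finset (S u) (S w) hST
    fun e => measurable_pi_apply e).comp (φ := φ u) (ψ := φ w)
      (measurable_of_finite _) (measurable_of_finite _)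
  let c : (Fin n → Bool) → Fin n → ℝ := fun a v =>
    if v ≠ u ∧ v ≠ w then centeredBit x u v (a v) else 0
  have hc : ∀ a v, |c a v| ≤ 1 := fun a v => by
    simp only [c]
    split_ifs
    · exact abs_centeredBit_le hx u v _
    · simp
  let Q : (Fin n → Bool) → Set (Fin n → Bool) := fun a =>
    {β | ε * n ≤ |∑ v, c a v * centeredBit x w v (β v)|}
  refine le_trans (measure_mono ?_) (measure_mem_le_of_indepFun (Q := Q)
    (measurable_of_finite _) hind (fun a => Set.toFinite _ |>.measurableSet) fun a => ?_)
  · intro b hb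
    refine le_trans (Set.mem_ofPred_eq.mp hb) (le_of_eq ?_)
    congr 1
    refine Finset.sum_congr rfl fun v _ => ?_
    simp only [c, φ, Function.comp_apply]
    split_ifs <;> simp
  · refine le_trans (measure_mono ?_) (edgeMeasure_abs_sum_ge_le hx w (hc a) hε)
    intro b hb
    refine le_trans (Set.mem_ofPred_eq.mp (Set.mem_preimage.1 hb)) (le_of_eq ?_)
    congr 1
    refine Finset.sum_congr rfl fun v _ => ?_
    simp only [c, φ, Function.comp_apply]
    split_ifs <;> simp

theorem noise_graphOfBits (b : Fin n × Fin n → Bool) (u v : Fin n) :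
    noise (adjacency (graphOfBits b)) x u v =
      if u = v then -inner ℝ (x u) (x v) else centeredBit x u v (b (edge u v)) := by
  classical
  by_cases huv : u = v
  · simp [noise, adjacency, huv]
  · have hadj : (graphOfBits b).Adj u v ↔ b (edge u v) = true := by simp [graphOfBits, huv]
    simp [noise, adjacency, centeredBit, huv, SimpleGraph.adjMatrix_apply, hadj]

theorem abs_noise_le (hx : ∀ u v, inner ℝ (x u) (x v) ∈ Set.Icc (0 : ℝ) 1)
    (b : Fin n × Fin n → Bool) (u v : Fin n) : |noise (adjacency (graphOfBits b)) x u v| ≤ 1 := by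
  rw [noise_graphOfBits]
  split_ifs
  · rw [abs_neg, abs_of_nonneg (hx u v).1]
    exact (hx u v).2
  · exact abs_centeredBit_le hx u v _

theorem abs_coord_le_one {y : EuclideanSpace ℝ (Fin D)} (hy : inner ℝ y y ≤ (1 : ℝ)) (k : Fin D) :
    |y k| ≤ 1 := by
  rw [real_inner_self_eq_norm_sq] at hy
  have h1 : ‖y‖ ≤ 1 := by nlinarith [norm_nonneg y]
  exact (PiLp.norm_apply_le y k).trans h1

/-- The noise of the graph `g` is quasirandom and nearly orthogonal to the latent positions. -/
def IsQuasirandom (η : ℝ) (x : Fin n → EuclideanSpace ℝ (Fin D)) (g : SimpleGraph (Fin n)) :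
    Prop :=
  (∀ u w, u ≠ w → |∑ v, noise (adjacency g) x u v * noise (adjacency g) x v w| ≤ η * n) ∧
    ∀ u k, |∑ w, noise (adjacency g) x u w * x w k| ≤ η * n

/-- Random graphs with independent edges are quasirandom with overwhelming probability. -/
theorem edgeMeasure_not_isQuasirandom_le
    (hx : ∀ u v, inner ℝ (x u) (x v) ∈ Set.Icc (0 : ℝ) 1) {η : ℝ} (hη : 0 ≤ η) (hn : 4 ≤ η * n) :
    edgeMeasure x {b | ¬ IsQuasirandom η x (graphOfBits b)} ≤
      ENNReal.ofReal ((n * n + n * D) * (2 * Real.exp (-((η / 2) ^ 2 / 2 * n)))) := by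
  classical
  set δ := 2 * Real.exp (-((η / 2) ^ 2 / 2 * n))
  have h1 : ∀ u w, u ≠ w → edgeMeasure x {b | η * n < |∑ v, noise (adjacency (graphOfBits b)) x u v *
      noise (adjacency (graphOfBits b)) x v w|} ≤ ENNReal.ofReal δ := by
    intro u w huw
    refine le_trans (measure_mono fun b hb => ?_)
      (edgeMeasure_abs_sum_mul_ge_le hx huw (by positivity : 0 ≤ η / 2))
    simp only [Set.mem_ofPred_eq] at hb ⊢
    set N := noise (adjacency (graphOfBits b)) x
    have hsplit : ∑ v, N u v * N v w = (∑ v, if v ≠ u ∧ v ≠ w then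
        centeredBit x u v (b (edge u v)) * centeredBit x w v (b (edge w v)) else 0) +
        (N u u * N u w + N u w * N w w) := by
      have h2 : N u u * N u w + N u w * N w w =
          ∑ v, ((if v = u then N u v * N v w else 0) + if v = w then N u v * N v w else 0) := by
        rw [Finset.sum_add_distrib]
        simp
      rw [h2, ← Finset.sum_add_distrib]
      refine Finset.sum_congr rfl fun v _ => ?_
      by_cases hvu : v = u
      · subst hvu; simp [huw]
      · by_cases hvw : v = w
        · subst hvw; simp [hvu]
        · simp only [N, noise_graphOfBits, hvu, hvw, Ne.symm hvu, ne_eq, not_false_eq_true,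
            and_self, if_true, if_false, add_zero]
          rw [edge_comm w v]
          congr 1
          simp only [centeredBit, real_inner_comm]
    have hb1 : |N u u * N u w + N u w * N w w| ≤ 2 := by
      have e : ∀ a b c d, |N a b * N c d| ≤ 1 := fun a b' c d => by
        rw [abs_mul]
        exact mul_le_one₀ (abs_noise_le hx b _ _) (abs_nonneg _) (abs_noise_le hx b _ _)
      exact (abs_add_le _ _).trans (by linarith [e u u u w, e u w w w])
    rw [hsplit] at hb
    have := abs_add_le (∑ v, if v ≠ u ∧ v ≠ w then
        centeredBit x u v (b (edge u v)) * centeredBit x w v (b (edge w v)) else 0)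
        (N u u * N u w + N u w * N w w)
    linarith
  have h2 : ∀ u k, edgeMeasure x {b | η * n < |∑ w, noise (adjacency (graphOfBits b)) x u w *
      x w k|} ≤ ENNReal.ofReal δ := by
    intro u k
    have hc : ∀ w, |if w = u then 0 else x w k| ≤ 1 := fun w => by
      split_ifs
      · simp
      · exact abs_coord_le_one (hx w w).2 k
    refine le_trans (measure_mono fun b hb => ?_)
      (edgeMeasure_abs_sum_ge_le hx u hc (by positivity : 0 ≤ η / 2))
    simp only [Set.mem_ofPred_eq] at hb ⊢
    set N := noise (adjacency (graphOfBits b)) x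
    have hsplit : ∑ w, N u w * x w k = (∑ w, (if w = u then 0 else x w k) *
        centeredBit x u w (b (edge u w))) + N u u * x u k := by
      have h3 : N u u * x u k = ∑ w, if w = u then N u w * x w k else 0 := by simp
      rw [h3, ← Finset.sum_add_distrib]
      refine Finset.sum_congr rfl fun w _ => ?_
      by_cases hwu : w = u
      · simp [hwu]
      · simp only [N, noise_graphOfBits, hwu, Ne.symm hwu, if_false, add_zero]
        ring
    have hb1 : |N u u * x u k| ≤ 1 := by
      rw [abs_mul]
      exact mul_le_one₀ (abs_noise_le hx b _ _) (abs_nonneg _) (abs_coord_le_one (hx u u).2 k)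
    rw [hsplit] at hb
    have := abs_add_le (∑ w, (if w = u then 0 else x w k) *
        centeredBit x u w (b (edge u w))) (N u u * x u k)
    linarith
  have hsub : {b | ¬ IsQuasirandom η x (graphOfBits b)} ⊆
      (⋃ u, ⋃ w, {b | u ≠ w ∧ η * n < |∑ v, noise (adjacency (graphOfBits b)) x u v *
        noise (adjacency (graphOfBits b)) x v w|}) ∪
      ⋃ u, ⋃ k, {b | η * n < |∑ w, noise (adjacency (graphOfBits b)) x u w * x w k|} := by
    intro b hb
    simp only [IsQuasirandom, Set.mem_ofPred_eq, not_and_or, not_forall, not_le] at hb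
    rcases hb with ⟨u, w, huw, h⟩ | ⟨u, k, h⟩
    · exact Or.inl (Set.mem_iUnion₂.2 ⟨u, w, huw, h⟩)
    · exact Or.inr (Set.mem_iUnion₂.2 ⟨u, k, h⟩)
  have hδ : 0 ≤ δ := by positivity
  have h1' : ∀ u w, edgeMeasure x {b | u ≠ w ∧ η * n < |∑ v,
      noise (adjacency (graphOfBits b)) x u v * noise (adjacency (graphOfBits b)) x v w|} ≤
        ENNReal.ofReal δ := fun u w => by
    by_cases huw : u = w
    · simp [huw]
    · exact (measure_mono fun b hb => hb.2).trans (h1 u w huw)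
  calc _ ≤ _ := measure_mono hsub
    _ ≤ _ := measure_union_le _ _
    _ ≤ (∑ _u : Fin n, ∑ _w : Fin n, ENNReal.ofReal δ) +
        ∑ _u : Fin n, ∑ _k : Fin D, ENNReal.ofReal δ := by
      refine add_le_add ?_ ?_ <;> refine (measure_iUnion_fintype_le _ _).trans
        (Finset.sum_le_sum fun u _ => (measure_iUnion_fintype_le _ _).trans
          (Finset.sum_le_sum fun w _ => ?_))
      · exact h1' u w
      · exact h2 u w
    _ = _ := by
      have hnn : 0 ≤ (n * n : ℝ) := by positivity
      have hnD : 0 ≤ (n * D : ℝ) := by positivity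
      rw [ENNReal.ofReal_mul (add_nonneg hnn hnD), ENNReal.ofReal_add hnn hnD,
        ENNReal.ofReal_mul n.cast_nonneg, ENNReal.ofReal_mul n.cast_nonneg]
      simp
      ring

end EdgeMeasure

/-! ### Random dot product graphs -/

section RandomGraph

variable {Ω : Type*} [MeasurableSpace Ω] {P : Measure Ω} {n D : ℕ}
  {F : Measure (EuclideanSpace ℝ (Fin D))} {X : Fin n → Ω → EuclideanSpace ℝ (Fin D)}
  {G : Ω → SimpleGraph (Fin n)}

/-- An event that is unlikely for independent edges with any fixed latent positions in a finite
set is unlikely for the random dot product graph. -/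
theorem IsRDPG.measure_le_of_edgeMeasure_le [IsProbabilityMeasure P] (h : IsRDPG P F X G)
    {V : Set (EuclideanSpace ℝ (Fin D))} (hVfin : V.Finite)
    (hV : ∀ᵐ ω ∂P, ∀ v, X v ω ∈ V)
    (hin : ∀ y ∈ V, ∀ z ∈ V, inner ℝ y z ∈ Set.Icc (0 : ℝ) 1)
    {Q : (Fin n → EuclideanSpace ℝ (Fin D)) → SimpleGraph (Fin n) → Prop} {δ : ENNReal}
    (hQ : ∀ x, (∀ v, x v ∈ V) → edgeMeasure x {b | Q x (graphOfBits b)} ≤ δ) :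
    P {ω | Q (fun v => X v ω) (G ω)} ≤ δ := by
  classical
  have := Fintype.ofFinite (SimpleGraph (Fin n))
  set Xv : Ω → Fin n → EuclideanSpace ℝ (Fin D) := fun ω v => X v ω with hXv
  have hXm : Measurable Xv := measurable_pi_lambda _ h.measurable_X
  let T : Finset (Fin n → EuclideanSpace ℝ (Fin D)) := Fintype.piFinset fun _ => hVfin.toFinset
  have hT : ∀ x, x ∈ T ↔ ∀ v, x v ∈ V := by simp [T, Fintype.mem_piFinset]
  have hcond : ∀ x g, P {ω | Xv ω ∈ ({x} : Set _) ∧ G ω = g} =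
      ENNReal.ofReal (edgeLikelihood x g) * P (Xv ⁻¹' {x}) := fun x g => by
    rw [h.cond_law {x} (measurableSet_singleton x) g]
    change ∫⁻ ω in Xv ⁻¹' {x}, ENNReal.ofReal (edgeLikelihood (Xv ω) g) ∂P = _
    rw [setLIntegral_congr_fun (g := fun _ => ENNReal.ofReal (edgeLikelihood x g))
      (hXm (measurableSet_singleton x)) (fun ω hω => by
        have : Xv ω = x := hω
        simp only [← this, hXv]), setLIntegral_const]
  have hfix : ∀ x ∈ T, ∑ g with Q x g, ENNReal.ofReal (edgeLikelihood x g) ≤ δ := fun x hx => by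
    have hx' := fun u v => hin _ ((hT x).1 hx u) _ ((hT x).1 hx v)
    have h1 := sum_measure_preimage_singleton (μ := edgeMeasure x) (f := graphOfBits)
      {g | Q x g} fun g _ => (Set.toFinite _).measurableSet
    have h2 : ∀ g, edgeMeasure x (graphOfBits ⁻¹' {g}) = ENNReal.ofReal (edgeLikelihood x g) :=
      edgeMeasure_graphOfBits_eq hx'
    simp only [h2] at h1
    rw [h1]
    refine le_trans (measure_mono fun b hb => ?_) (hQ x ((hT x).1 hx))
    simpa using hb
  have hsub : {ω | Q (Xv ω) (G ω)} ⊆ {ω | ¬ ∀ v, X v ω ∈ V} ∪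
      ⋃ x ∈ T, ⋃ g ∈ ({g | Q x g} : Finset _), {ω | Xv ω ∈ ({x} : Set _) ∧ G ω = g} := by
    intro ω hω
    by_cases hXV : ∀ v, X v ω ∈ V
    · refine Or.inr (Set.mem_iUnion₂.2 ⟨Xv ω, (hT _).2 hXV,
        Set.mem_iUnion₂.2 ⟨G ω, ?_, rfl, rfl⟩⟩)
      simpa using hω
    · exact Or.inl hXV
  calc _ ≤ _ := measure_mono hsub
    _ ≤ _ := measure_union_le _ _
    _ ≤ 0 + ∑ x ∈ T, ∑ g with Q x g, P {ω | Xv ω ∈ ({x} : Set _) ∧ G ω = g} := by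
      refine add_le_add (ae_iff.1 hV).le ((measure_biUnion_finset_le _ _).trans
        (Finset.sum_le_sum fun x _ => measure_biUnion_finset_le _ _))
    _ = ∑ x ∈ T, (∑ g with Q x g, ENNReal.ofReal (edgeLikelihood x g)) * P (Xv ⁻¹' {x}) := by
      simp only [hcond, zero_add, Finset.sum_mul]
    _ ≤ ∑ x ∈ T, δ * P (Xv ⁻¹' {x}) := Finset.sum_le_sum fun x hx => by
      gcongr
      exact hfix x hx
    _ = δ * P (Xv ⁻¹' T) := by
      rw [← Finset.mul_sum, sum_measure_preimage_singleton _ fun x _ =>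
        hXm (measurableSet_singleton x)]
    _ ≤ δ * 1 := by
      gcongr
      exact prob_le_one
    _ = δ := mul_one δ

/-- Concentration of empirical means of a bounded function of the latent positions. -/
theorem IsRDPG.measure_abs_mean_sub_ge_le [IsProbabilityMeasure P] (h : IsRDPG P F X G)
    (hn : 0 < n) {φ : EuclideanSpace ℝ (Fin D) → ℝ} (hφ : Measurable φ)
    (hb : ∀ᵐ y ∂F, |φ y| ≤ 1) {ε : ℝ} (hε : 0 ≤ ε) :
    P {ω | ε ≤ |(n : ℝ)⁻¹ * ∑ v, φ (X v ω) - ∫ y, φ y ∂F|} ≤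
      ENNReal.ofReal (2 * Real.exp (-((ε / 2) ^ 2 / 2 * n))) := by
  have hF : IsProbabilityMeasure F := by
    rw [← h.law ⟨0, hn⟩]
    exact Measure.isProbabilityMeasure_map (h.measurable_X _).aemeasurable
  set m := ∫ y, φ y ∂F
  have hm : |m| ≤ 1 := by
    have := norm_integral_le_of_norm_le_const (μ := F) (f := φ) (C := 1) hb
    simpa using this
  have hbX : ∀ v, ∀ᵐ ω ∂P, |φ (X v ω)| ≤ 1 := fun v =>
    ae_of_ae_map (h.measurable_X v).aemeasurable (by rw [h.law v]; exact hb)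
  have hint : ∀ v, ∫ ω, φ (X v ω) ∂P = m := fun v => by
    rw [← integral_map (h.measurable_X v).aemeasurable hφ.aestronglyMeasurable, h.law v]
  have hI : ∀ v, Integrable (fun ω => φ (X v ω)) P := fun v =>
    Integrable.of_bound (hφ.comp (h.measurable_X v)).aestronglyMeasurable 1 (hbX v)
  have hind := h.indep.comp (fun _ y => (φ y - m) / 2) fun _ => (hφ.sub_const m).div_const 2
  have hmain := measure_abs_sum_ge_le hind
    (fun v => ((hφ.sub_const m).div_const 2).comp (h.measurable_X v))
    (fun v => (hbX v).mono fun ω hω => ?_) (fun v => ?_) (by positivity : 0 ≤ ε / 2)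
  · refine le_trans (measure_mono fun ω hω => ?_) hmain
    simp only [Set.mem_ofPred_eq, Function.comp_apply] at hω ⊢
    have hn' : (0 : ℝ) < n := by exact_mod_cast hn
    have e : ∑ v, (φ (X v ω) - m) / 2 = ((n : ℝ)⁻¹ * ∑ v, φ (X v ω) - m) * (n / 2) := by
      rw [← Finset.sum_div, Finset.sum_sub_distrib]
      simp
      field_simp
    rw [e, abs_mul, abs_of_pos (by positivity : (0 : ℝ) < n / 2)]
    calc ε / 2 * n = ε * (n / 2) := by ring
      _ ≤ _ := by gcongr
  · simp only [Function.comp_apply]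
    rw [abs_le] at hω hm ⊢
    constructor <;> linarith [hω.1, hω.2, hm.1, hm.2]
  · simp only [Function.comp_apply]
    rw [integral_div, integral_sub (hI v) (integrable_const m), hint v]
    simp

end RandomGraph

/-! ### The blockmodel -/

namespace Params

variable {R : ℕ} {K : Fin R → ℕ} {D : ℕ} (M : Params R K D)

theorem ae_dist_iff (p : EuclideanSpace ℝ (Fin D) → Prop) :
    (∀ᵐ x ∂M.dist, p x) ↔ ∀ i j, p (M.ξ i j) := by
  have h1 : ∀ i, ¬ M.π i ≤ 0 := fun i => not_le.2 (M.π_mem i).1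
  have h2 : ∀ i j, ¬ M.πsub i j ≤ 0 := fun i j => not_le.2 (M.πsub_pos i j)
  rw [ae_iff]
  simp [dist, Measure.finsetSum_apply, h1, h2]

theorem le_dist_real_block [IsProbabilityMeasure M.dist] (i : Fin R) :
    M.π i ≤ M.dist.real (Set.range (M.ξ i)) := by
  have h1 : ENNReal.ofReal (M.π i) ≤ M.dist (Set.range (M.ξ i)) := by
    have h2 : ∑ j, ENNReal.ofReal (M.πsub i j) = 1 := by
      rw [← ENNReal.ofReal_sum_of_nonneg fun j _ => (M.πsub_pos i j).le, M.sum_πsub]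
      simp
    rw [dist, Measure.finsetSum_apply]
    refine le_trans (le_of_eq ?_) (Finset.single_le_sum (fun _ _ => zero_le) (Finset.mem_univ i))
    simp [Measure.finsetSum_apply, h2]
  rw [measureReal_def]
  exact (ENNReal.ofReal_le_iff_le_toReal (measure_ne_top _ _)).1 h1

theorem q_le (i : Fin R) (j l : Fin (K i)) : M.q ≤ inner ℝ (M.ξ i j) (M.ξ i l) :=
  ciInf_le (Set.finite_range fun x : Σ i, Fin (K i) × Fin (K i) =>
    (inner ℝ (M.ξ x.1 x.2.1) (M.ξ x.1 x.2.2) : ℝ)).bddBelow ⟨i, j, l⟩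

theorem le_p {i i' : Fin R} (h : i ≠ i') (j : Fin (K i)) (l : Fin (K i')) :
    inner ℝ (M.ξ i j) (M.ξ i' l) ≤ M.p :=
  le_ciSup (Set.finite_range fun x : {x : (Σ i, Fin (K i)) × (Σ i, Fin (K i)) // x.1.1 ≠ x.2.1} =>
    (inner ℝ (M.ξ x.1.1.1 x.1.1.2) (M.ξ x.1.2.1 x.1.2.2) : ℝ)).bddAbove ⟨(⟨i, j⟩, ⟨i', l⟩), h⟩

end Params

/-! ### Constants -/

section Constants

open scoped Matrix.Norms.L2Operator

theorem isUnit_of_rank_eq {D : ℕ} {Δ : Matrix (Fin D) (Fin D) ℝ} (h : Δ.rank = D) : IsUnit Δ := by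
  have h1 : Function.Surjective Δ.mulVecLin := by
    rw [← LinearMap.range_eq_top]
    exact Submodule.eq_top_of_finrank_eq (by rw [← Matrix.rank]; simpa using h)
  exact Matrix.mulVec_surjective_iff_isUnit.1 h1

/-- Inverses of perturbations of an invertible matrix are uniformly bounded. -/
theorem exists_inverse_bound {D : ℕ} {Δ : Matrix (Fin D) (Fin D) ℝ} (h : IsUnit Δ) :
    ∃ B ε : ℝ, 1 ≤ B ∧ 0 < ε ∧ ∀ C, ‖C - Δ‖ < ε → ∃ C', C' * C = 1 ∧ C * C' = 1 ∧ ‖C'‖ ≤ B := by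
  obtain ⟨w, rfl⟩ := h
  have hc := (NormedRing.inverse_continuousAt w).norm
  have h1 := hc.eventually (gt_mem_nhds (lt_add_one _))
  have h2 : ∀ᶠ C in nhds (w : Matrix (Fin D) (Fin D) ℝ), IsUnit C :=
    Units.isOpen.mem_nhds w.isUnit
  obtain ⟨ε, hε, hball⟩ := Metric.eventually_nhds_iff.1 (h1.and h2)
  refine ⟨_, ε, le_add_of_nonneg_left (norm_nonneg (Ring.inverse (w : Matrix (Fin D) (Fin D) ℝ))),
    hε, fun C hC => ?_⟩
  obtain ⟨h3, h4⟩ := hball (by rwa [dist_eq_norm])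
  exact ⟨Ring.inverse C, Ring.inverse_mul_cancel C h4, Ring.mul_inverse_cancel C h4, h3.le⟩

theorem l2_opNorm_lt_of_abs_lt {D : ℕ} {M : Matrix (Fin D) (Fin D) ℝ} {ε : ℝ} (hε : 0 < ε)
    (h : ∀ a b, |M a b| < ε / (D + 1)) : ‖M‖ < ε := by
  have hD : (0 : ℝ) < D + 1 := by positivity
  refine lt_of_le_of_lt (l2_opNorm_le_of_sum_sq_le (c := D * (ε / (D + 1))) (by positivity) ?_) ?_
  · calc _ ≤ ∑ _a : Fin D, ∑ _b : Fin D, (ε / (D + 1)) ^ 2 :=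
          Finset.sum_le_sum fun a _ => Finset.sum_le_sum fun b _ => by
            rw [← sq_abs]
            have := (h a b).le
            gcongr
      _ = _ := by simp; ring
  · rw [mul_div_assoc', div_lt_iff₀ hD]
    nlinarith

/-- The tolerances needed to estimate Gram matrices up to `γ`. -/
theorem exists_tolerances (D : ℕ) {B γ : ℝ} (hB : 1 ≤ B) (hγ : 0 < γ) :
    ∃ η ε ε₁ : ℝ, 0 < η ∧ η ≤ 1 ∧ 0 ≤ ε ∧ 2 * η ≤ ε ^ 4 ∧ D * η ^ 2 ≤ ε ^ 2 ∧ 0 ≤ ε₁ ∧ ε ≤ ε₁ ∧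
      2 * ε ≤ ε₁ ^ 2 ∧ 2 * B * ε₁ ≤ 1 ∧ 168 * B ^ 8 * ε₁ < γ := by
  have hB0 : 0 < B := by linarith
  obtain ⟨ε₁, hε₁, h1, h2⟩ : ∃ ε₁ : ℝ, 0 < ε₁ ∧ ε₁ ≤ 1 / (2 * B) ∧ ε₁ < γ / (168 * B ^ 8) := by
    have ha : 0 < 1 / (2 * B) := by positivity
    have hb : 0 < γ / (168 * B ^ 8) := by positivity
    exact ⟨min (1 / (2 * B)) (γ / (168 * B ^ 8) / 2), by positivity, min_le_left _ _,
      lt_of_le_of_lt (min_le_right _ _) (by linarith)⟩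
  obtain ⟨ε, hε, h3, h4⟩ : ∃ ε : ℝ, 0 < ε ∧ ε ≤ ε₁ ∧ ε ≤ ε₁ ^ 2 / 2 :=
    ⟨min ε₁ (ε₁ ^ 2 / 2), by positivity, min_le_left _ _, min_le_right _ _⟩
  obtain ⟨η, hη, h5, h6, h7⟩ : ∃ η : ℝ, 0 < η ∧ η ≤ 1 ∧ η ≤ ε ^ 4 / 2 ∧ η ≤ ε / (D + 1) :=
    ⟨min 1 (min (ε ^ 4 / 2) (ε / (D + 1))), by positivity, min_le_left _ _,
      (min_le_right _ _).trans (min_le_left _ _), (min_le_right _ _).trans (min_le_right _ _)⟩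
  refine ⟨η, ε, ε₁, hη, h5, hε.le, by linarith, ?_, hε₁.le, h3, by linarith, ?_, ?_⟩
  · rw [le_div_iff₀ (by positivity)] at h7
    calc D * η ^ 2 ≤ (η * (D + 1)) ^ 2 := by
          have : (0 : ℝ) ≤ D := D.cast_nonneg
          nlinarith [sq_nonneg η, mul_nonneg this (sq_nonneg η),
            mul_nonneg (mul_nonneg this this) (sq_nonneg η)]
      _ ≤ ε ^ 2 := by gcongr
  · rw [le_div_iff₀ (by positivity)] at h1
    linarith
  · rw [lt_div_iff₀ (by positivity)] at h2
    linarith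

end Constants

/-! ### Overwhelming probability -/

section Asymptotics

open Asymptotics Filter

theorem superpolynomialDecay_exp {κ : ℝ} (hκ : 0 < κ) :
    SuperpolynomialDecay atTop (fun n : ℕ => (n : ℝ)) fun n => Real.exp (-(κ * n)) := fun k => by
  have h := (tendsto_rpow_mul_exp_neg_mul_atTop_nhds_zero k κ hκ).comp
    (tendsto_natCast_atTop_atTop (R := ℝ))
  simpa [Function.comp_def] using h

theorem asymptoticallyAlmostSurely_of_superpolynomialDecay {Ω : ℕ → Type*}
    [∀ n, MeasurableSpace (Ω n)] {P : ∀ n, Measure (Ω n)} [∀ n, IsProbabilityMeasure (P n)]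
    {E : ∀ n, Set (Ω n)} {f : ℕ → ℝ}
    (hf : SuperpolynomialDecay atTop (fun n : ℕ => (n : ℝ)) f) {N : ℕ}
    (h : ∀ n, N ≤ n → (P n).real (E n)ᶜ ≤ f n) : AsymptoticallyAlmostSurely P E := by
  intro c hc
  have h1 := (hf ⌈c⌉₊).eventually (gt_mem_nhds zero_lt_one)
  obtain ⟨n₁, hn₁⟩ := eventually_atTop.1 h1
  refine ⟨max N (max n₁ 1), fun n hn η hη _ => ?_⟩
  have hnN : N ≤ n := (le_max_left _ _).trans hn.le
  have hn1 : n₁ ≤ n := ((le_max_left _ _).trans (le_max_right _ _)).trans hn.le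
  have hn0 : (1 : ℝ) ≤ n := by
    exact_mod_cast ((le_max_right _ _).trans (le_max_right _ _)).trans hn.le
  have hfn : f n ≤ (n : ℝ) ^ (-c) := by
    have h2 := (hn₁ n hn1).le
    have hpos : (0 : ℝ) < (n : ℝ) ^ c := by positivity
    rw [Real.rpow_neg (by positivity), ← one_div, le_div_iff₀ hpos]
    rcases le_or_gt (f n) 0 with hneg | hfpos
    · nlinarith
    · calc f n * (n : ℝ) ^ c ≤ f n * (n : ℝ) ^ ⌈c⌉₊ := by
            gcongr
            rw [← Real.rpow_natCast]
            exact Real.rpow_le_rpow_of_exponent_le hn0 (Nat.le_ceil c)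
        _ = (n : ℝ) ^ ⌈c⌉₊ * f n := mul_comm _ _
        _ ≤ 1 := h2
  have h3 := measureReal_union_le (μ := P n) (E n) (E n)ᶜ
  rw [Set.union_compl_self, probReal_univ] at h3
  linarith [h n hnN]

end Asymptotics

/-! ### Exact recovery -/

section Recovery

variable {R : ℕ} {K : Fin R → ℕ} {D n : ℕ} {M : Params R K D}

theorem adjacency_transpose (g : SimpleGraph (Fin n)) : (adjacency g).transpose = adjacency g := by
  classical
  exact SimpleGraph.transpose_adjMatrix g

theorem adjacency_mem_Icc (g : SimpleGraph (Fin n)) (u v : Fin n) :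
    adjacency g u v ∈ Set.Icc (0 : ℝ) 1 := by
  classical
  rw [adjacency, SimpleGraph.adjMatrix_apply]
  split_ifs <;> simp

/-- Under the affinity assumption, clustering is exact as soon as the Gram matrix of the embedding
is within `(q - p) / 2` of that of the latent positions and no subgraph is empty. -/
theorem clusteringError_eq_zero_of_gram_close {x : Fin n → EuclideanSpace ℝ (Fin D)}
    {t : Fin n → Fin R} (ht : ∀ v, ∃ j, x v = M.ξ (t v) j) (hsurj : Function.Surjective t)
    {Xhat : Fin n → EuclideanSpace ℝ (Fin D)}
    (hclose : ∀ u v, |inner ℝ (Xhat u) (Xhat v) - inner ℝ (x u) (x v)| < (M.q - M.p) / 2)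
    {τhat : Fin n → Fin R} (hτ : IsClusteringOutput Xhat τhat) : clusteringError τhat t = 0 := by
  refine hτ.clusteringError_eq_zero (m := (M.p + M.q) / 2) hsurj (fun u v huv => ?_)
    fun u v huv => ?_
  · obtain ⟨j, hj⟩ := ht u
    obtain ⟨l, hl⟩ : ∃ l, x v = M.ξ (t u) l := by
      rw [huv]
      exact ht v
    have h1 := M.q_le (t u) j l
    have h2 := (abs_lt.1 (hclose u v)).1
    rw [hj, hl] at h2
    linarith
  · obtain ⟨j, hj⟩ := ht u
    obtain ⟨l, hl⟩ := ht v
    have h1 := M.le_p huv j l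
    have h2 := (abs_lt.1 (hclose u v)).2
    rw [hj, hl] at h2
    linarith

/-- Distinct subgraphs have no common latent position. -/
theorem Params.eq_of_position_eq (haff : M.Affinity) {i i' : Fin R} {j : Fin (K i)}
    {l : Fin (K i')} (h : M.ξ i j = M.ξ i' l) : i = i' := by
  by_contra hne
  have h1 := M.q_le i j j
  have h2 := M.le_p hne j l
  rw [← h] at h2
  exact absurd (lt_of_le_of_lt (h1.trans h2) haff) (lt_irrefl _)

/-- Exact recovery of the subgraphs of a 2-level hierarchical stochastic blockmodel, with any number
of blocks in each subgraph. -/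
theorem asymptoticallyAlmostSurely_clusteringError_eq_zero (haff : M.Affinity)
    (hrank : (secondMoment M.dist).rank = D)
    {Ω : ℕ → Type*} [∀ n, MeasurableSpace (Ω n)]
    {P : ∀ n, Measure (Ω n)} [∀ n, IsProbabilityMeasure (P n)]
    {X : ∀ n, Fin n → Ω n → EuclideanSpace ℝ (Fin D)} {G : ∀ n, Ω n → SimpleGraph (Fin n)}
    (hG : ∀ n, IsRDPG (P n) M.dist (X n) (G n)) {τ : ∀ n, Ω n → Fin n → Fin R}
    (hτ : ∀ n, ∀ᵐ ω ∂(P n), ∀ v, ∃ j, X n v ω = M.ξ (τ n ω v) j) :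
    AsymptoticallyAlmostSurely P fun n =>
      {ω | ∀ (Xhat : Fin n → EuclideanSpace ℝ (Fin D)) (τhat : Fin n → Fin R),
        IsASE (adjacency (G n ω)) Xhat → IsClusteringOutput Xhat τhat →
          clusteringError τhat (τ n ω) = 0} := by
  classical
  have hprob : IsProbabilityMeasure M.dist := by
    rw [← (hG 1).law 0]
    exact Measure.isProbabilityMeasure_map ((hG 1).measurable_X 0).aemeasurable
  have hin : ∀ i j i' j', inner ℝ (M.ξ i j) (M.ξ i' j') ∈ Set.Icc (0 : ℝ) 1 := by
    obtain ⟨𝒳, h𝒳, h⟩ := (hG 1).inner_mem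
    rw [M.ae_dist_iff] at h𝒳
    exact fun i j i' j' => h _ (h𝒳 i j) _ (h𝒳 i' j')
  obtain ⟨B, εΔ, hB, hεΔ, hinv⟩ := exists_inverse_bound (isUnit_of_rank_eq hrank)
  obtain ⟨η, ε, ε₁, hη, hη1, hε, hηε, hηD, hε₁, hεε₁, h2ε, hεB, hγ⟩ :=
    exists_tolerances D hB (half_pos (sub_pos.2 haff))
  obtain ⟨ρ, hρ, hρπ⟩ : ∃ ρ : ℝ, 0 < ρ ∧ ∀ i, ρ ≤ M.π i := by
    rcases isEmpty_or_nonempty (Fin R) with hR | hR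
    · exact ⟨1, one_pos, fun i => hR.elim i⟩
    · obtain ⟨i₀, h⟩ := Finite.exists_min M.π
      exact ⟨M.π i₀, (M.π_mem i₀).1, h⟩
  set ε' := εΔ / (D + 1) with hε'
  have hε'0 : 0 < ε' := by positivity
  let V : Set (EuclideanSpace ℝ (Fin D)) := Set.range fun s : Σ i, Fin (K i) => M.ξ s.1 s.2
  have hVin : ∀ y ∈ V, ∀ z ∈ V, inner ℝ y z ∈ Set.Icc (0 : ℝ) 1 := by
    rintro _ ⟨s, rfl⟩ _ ⟨s', rfl⟩
    exact hin _ _ _ _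
  have hτV : ∀ n, ∀ᵐ ω ∂(P n), ∀ v, X n v ω ∈ V := fun n => (hτ n).mono fun ω hω v => by
    obtain ⟨j, hj⟩ := hω v
    exact ⟨⟨_, j⟩, hj.symm⟩
  let φ : Fin R → EuclideanSpace ℝ (Fin D) → ℝ := fun i => (Set.range (M.ξ i)).indicator 1
  have hφint : ∀ i, ρ ≤ ∫ y, φ i y ∂M.dist := fun i => by
    rw [integral_indicator_one (Set.finite_range _).measurableSet]
    exact (hρπ i).trans (M.le_dist_real_block i)
  let bad₁ : ∀ n, Set (Ω n) := fun n => {ω | ¬ IsQuasirandom η (fun v => X n v ω) (G n ω)}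
  let bad₂ : ∀ n, Fin D → Fin D → Set (Ω n) := fun n a b =>
    {ω | ε' ≤ |(n : ℝ)⁻¹ * ∑ v, X n v ω a * X n v ω b - ∫ y, y a * y b ∂M.dist|}
  let bad₃ : ∀ n, Fin R → Set (Ω n) := fun n i =>
    {ω | ρ ≤ |(n : ℝ)⁻¹ * ∑ v, φ i (X n v ω) - ∫ y, φ i y ∂M.dist|}
  let b₁ : ℕ → ℝ := fun n => (n * n + n * D) * (2 * Real.exp (-((η / 2) ^ 2 / 2 * n)))
  let b₂ : ℕ → ℝ := fun n => 2 * Real.exp (-((ε' / 2) ^ 2 / 2 * n))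
  let b₃ : ℕ → ℝ := fun n => 2 * Real.exp (-((ρ / 2) ^ 2 / 2 * n))
  have hdecay : Asymptotics.SuperpolynomialDecay Filter.atTop (fun n : ℕ => (n : ℝ))
      fun n => b₁ n + (D * D * b₂ n + R * b₃ n) := by
    have e₁ := (superpolynomialDecay_exp (by positivity : 0 < (η / 2) ^ 2 / 2)).const_mul 2
    have e₂ := (superpolynomialDecay_exp (by positivity : 0 < (ε' / 2) ^ 2 / 2)).const_mul 2
    have e₃ := (superpolynomialDecay_exp (by positivity : 0 < (ρ / 2) ^ 2 / 2)).const_mul 2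
    have e₁' := e₁.param_mul.param_mul.add (e₁.param_mul.const_mul (D : ℝ))
    refine Asymptotics.SuperpolynomialDecay.add ?_
      ((e₂.const_mul ((D : ℝ) * D)).add (e₃.const_mul (R : ℝ)))
    convert e₁' using 1
    ext n
    simp only [b₁, Pi.add_apply, Pi.mul_apply]
    ring
  refine asymptoticallyAlmostSurely_of_superpolynomialDecay hdecay (N := ⌈4 / η⌉₊ + 1)
    fun n hn => ?_
  have hn0 : 0 < n := (Nat.succ_pos _).trans_le hn
  have hnη : 4 ≤ η * n := by
    have h1 : 4 / η ≤ n := (Nat.le_ceil _).trans (by exact_mod_cast (Nat.le_succ _).trans hn)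
    rw [div_le_iff₀ hη] at h1
    linarith
  have hbad₁ : P n (bad₁ n) ≤ ENNReal.ofReal (b₁ n) :=
    (hG n).measure_le_of_edgeMeasure_le (Set.finite_range _) (hτV n) hVin
      (Q := fun x g => ¬ IsQuasirandom η x g) fun x hx =>
        edgeMeasure_not_isQuasirandom_le (fun u v => hVin _ (hx u) _ (hx v)) hη.le hnη
  have hbad₂ : ∀ a b, P n (bad₂ n a b) ≤ ENNReal.ofReal (b₂ n) := fun a b => by
    refine (hG n).measure_abs_mean_sub_ge_le hn0 (φ := fun y => y a * y b) (by fun_prop) ?_ hε'0.le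
    rw [M.ae_dist_iff]
    intro i j
    rw [abs_mul]
    exact mul_le_one₀ (abs_coord_le_one (hin i j i j).2 a) (abs_nonneg _)
      (abs_coord_le_one (hin i j i j).2 b)
  have hbad₃ : ∀ i, P n (bad₃ n i) ≤ ENNReal.ofReal (b₃ n) := fun i => by
    refine (hG n).measure_abs_mean_sub_ge_le hn0 (φ := φ i)
      (measurable_one.indicator (Set.finite_range _).measurableSet)
      (Filter.Eventually.of_forall fun y => ?_) hρ.le
    simp only [φ, Set.indicator_apply]
    split_ifs <;> simp
  have hsub : {ω | ∀ (Xhat : Fin n → EuclideanSpace ℝ (Fin D)) (τhat : Fin n → Fin R),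
      IsASE (adjacency (G n ω)) Xhat → IsClusteringOutput Xhat τhat →
        clusteringError τhat (τ n ω) = 0}ᶜ ⊆
      {ω | ¬ ∀ v, ∃ j, X n v ω = M.ξ (τ n ω v) j} ∪
        (bad₁ n ∪ ((⋃ a, ⋃ b, bad₂ n a b) ∪ ⋃ i, bad₃ n i)) := by
    intro ω hω
    by_contra hgood
    simp only [Set.mem_union, Set.mem_iUnion, not_or, not_exists, bad₁, bad₂, bad₃,
      Set.mem_ofPred_eq, not_not, not_le] at hgood
    obtain ⟨hlabel, hquasi, hmoment, hblock⟩ := hgood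
    refine hω fun Xhat τhat hASE hout => ?_
    have hx : ∀ u v, inner ℝ (X n u ω) (X n v ω) ∈ Set.Icc (0 : ℝ) 1 := fun u v => by
      obtain ⟨j, hj⟩ := hlabel u
      obtain ⟨l, hl⟩ := hlabel v
      rw [hj, hl]
      exact hin _ _ _ _
    have hsurj : Function.Surjective (τ n ω) := fun i => by
      by_contra hno
      have hzero : ∀ v, φ i (X n v ω) = 0 := fun v => by
        refine Set.indicator_of_notMem ?_ _
        rintro ⟨j, hj⟩
        obtain ⟨l, hl⟩ := hlabel v
        exact hno ⟨v, (Params.eq_of_position_eq haff (hj.trans hl)).symm⟩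
      have h1 := hblock i
      simp only [hzero, Finset.sum_const_zero, mul_zero, zero_sub, abs_neg] at h1
      exact absurd (h1.trans_le ((hφint i).trans (le_abs_self _))) (lt_irrefl _)
    obtain ⟨C', hC, hC', hCB⟩ := hinv (empiricalMoment fun v => X n v ω)
      (l2_opNorm_lt_of_abs_lt hεΔ fun a b => hmoment a b)
    refine clusteringError_eq_zero_of_gram_close hlabel hsurj (fun u v => ?_) hout
    exact (hASE.abs_inner_sub_le (adjacency_transpose _) (adjacency_mem_Icc _) hx hC hC' hB hCB hη1
      (by linarith) hε hηε hηD hε₁ hεε₁ h2ε hεB hquasi.1 hquasi.2 u v).trans_lt hγ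
  have hb : ∀ n, 0 ≤ b₁ n ∧ 0 ≤ b₂ n ∧ 0 ≤ b₃ n := fun n =>
    ⟨by positivity, by positivity, by positivity⟩
  obtain ⟨hb₁, hb₂, hb₃⟩ := hb n
  refine ENNReal.toReal_le_of_le_ofReal (by positivity) ?_
  calc _ ≤ _ := measure_mono hsub
    _ ≤ 0 + (ENNReal.ofReal (b₁ n) + ((∑ _a : Fin D, ∑ _b : Fin D, ENNReal.ofReal (b₂ n)) +
        ∑ _i : Fin R, ENNReal.ofReal (b₃ n))) := by
      refine (measure_union_le _ _).trans (add_le_add (ae_iff.1 (hτ n)).le ?_)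
      refine (measure_union_le _ _).trans (add_le_add hbad₁ ?_)
      refine (measure_union_le _ _).trans (add_le_add ?_ ?_)
      · exact (measure_iUnion_fintype_le _ _).trans (Finset.sum_le_sum fun a _ =>
          (measure_iUnion_fintype_le _ _).trans (Finset.sum_le_sum fun b _ => hbad₂ a b))
      · exact (measure_iUnion_fintype_le _ _).trans (Finset.sum_le_sum fun i _ => hbad₃ i)
    _ = _ := by
      rw [ENNReal.ofReal_add hb₁ (by positivity), ENNReal.ofReal_add (by positivity) (by positivity),
        ENNReal.ofReal_mul (p := D * D) (by positivity), ENNReal.ofReal_mul D.cast_nonneg,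
        ENNReal.ofReal_mul R.cast_nonneg]
      simp
      ring

end Recovery

end HSBM

theorem mainTheorem4 {R K d : ℕ} (M : HSBM.Params R (fun _ => K) (R * d))
    (h_affinity : M.Affinity) (h_subspace : HSBM.SubspaceStructure M)
    (h_rank : (HSBM.secondMoment M.dist).rank = R * d)
    {Ω : ℕ → Type*} [∀ n, MeasurableSpace (Ω n)]
    (P : ∀ n, MeasureTheory.Measure (Ω n)) [∀ n, MeasureTheory.IsProbabilityMeasure (P n)]
    (X : ∀ n, Fin n → Ω n → EuclideanSpace ℝ (Fin (R * d)))
    (G : ∀ n, Ω n → SimpleGraph (Fin n))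
    (h_graph : ∀ n, HSBM.IsRDPG (P n) M.dist (X n) (G n))
    (τ : ∀ n, Ω n → Fin n → Fin R)
    (h_assignment : ∀ n, ∀ᵐ ω ∂(P n), ∀ v, ∃ j, X n v ω = M.ξ (τ n ω v) j) :
    HSBM.AsymptoticallyAlmostSurely P fun n =>
      {ω | ∀ (Xhat : Fin n → EuclideanSpace ℝ (Fin (R * d))) (τhat : Fin n → Fin R),
        HSBM.IsASE (HSBM.adjacency (G n ω)) Xhat → HSBM.IsClusteringOutput Xhat τhat →
          HSBM.clusteringError τhat (τ n ω) = 0} :=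
  HSBM.asymptoticallyAlmostSurely_clusteringError_eq_zero h_affinity h_rank h_graph h_assignment
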